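/- **Setting.** Let $t_0<t_f$, $I=(t_0,t_f)$, $n_x,n_g\in\mathbb N_0$, $x_0\in\mathbb R^{n_x}$. For $k\in\mathbb N_0$ let $\mathcal G^k$ be the space of functions $\mathbf g:I\times\mathbb R^{n_x}\to\mathbb R^{n_g}$ such that $\mathbf g(t,\cdot)$ is $k$ times continuously differentiable for a.a. $t\in I$, $\mathbf g(\cdot,x)$ is measurable for every $x$, and $$\|\mathbf g\|_{\mathcal G^k}:=\sum_{n=0}^k\operatorname*{ess\,sup}_{t\in I}\ \sup_{x\in\mathbb R^{n_x}}\|\mathbf g^{(n)}(t,x)\|<\infty ,$$ where $\mathbf g^{(n)}$ is the $n$-th derivative with respect to $x$ (functions with $\mathbf g(t,\cdot)=\tilde{\mathbf g}(t,\cdot)$ for a.a. $t$ being identified). Say that a function $\mathbf h:I\times\mathbb R^{n_x}\times\mathbb R^{n_g}\to\mathbb R^m$ satisfies assumption (S) if * for a.a. $t\in I$, $\mathbf h(t,\cdot,\cdot)$ is continuously differentiable with respect to $x$ and $g$; $\mathbf h(\cdot,x,g)$ is measurable for all $x,g$; * there is $K>0$ such that $\|\mathbf h(t,0,g)\|$,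 $\|\mathbf h_x(t,0,g)\|$ and $\|\mathbf h_g(t,0,g)\|$ are at most $K(\|g\|+1)$ for a.a. $t\in I$ and all $g$; * for every $R>0$ there is $L(R)$ such that, for a.a. $t\in I$ and all $x_1,x_2,g_1,g_2$ of norm at most $R$, both $\|\mathbf h(t,x_1,g_1)-\mathbf h(t,x_2,g_2)\|$ and $\|\mathbf h_x(t,x_1,g_1)-\mathbf h_x(t,x_2,g_2)\|+\|\mathbf h_g(t,x_1,g_1)-\mathbf h_g(t,x_2,g_2)\|$ are at most $L(R)(\|x_1-x_2\|+\|g_1-g_2\|)$. Let $\mathbf f:I\times\mathbb R^{n_x}\times\mathbb R^{n_g}\to\mathbb R^{n_x}$ and $l:I\times\mathbb R^{n_x}\times\mathbb R^{n_g}\to\mathbb R$ both satisfy (S), and let $\varphi:\mathbb R^{n_x}\to\mathbb R$ be continuously differentiable. For $\mathbf g\in\mathcal G^2$ let $\mathbf x(\cdot\,;\mathbf g)\in (W^{1,\infty}(I))^{n_x}$ denote the solution, if it exists, of $$\mathbf x'(t)=\mathbf f\big(t,\mathbf x(t),\mathbf g(t,\mathbf x(t))\big)\ \text{ for a.a. }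 t\in I,\qquad \mathbf x(t_0)=x_0,\tag{1}$$ and set $$\widehat q(\mathbf g):=\varphi\big(\mathbf x(t_f;\mathbf g)\big)+\int_{t_0}^{t_f}l\Big(t,\mathbf x(t;\mathbf g),\mathbf g\big(t,\mathbf x(t;\mathbf g)\big)\Big)\,dt .$$ **Theorem.** Let $\overline{\mathbf g}\in\mathcal G^2$ and let $\overline{\mathbf x}\in(W^{1,\infty}(I))^{n_x}$ solve (1) for $\mathbf g=\overline{\mathbf g}$. Put $$\overline{\mathbf B}(t)=\mathbf f_g\big(t,\overline{\mathbf x}(t),\overline{\mathbf g}(t,\overline{\mathbf x}(t))\big),\qquad \overline{\mathbf A}(t)=\mathbf f_x\big(t,\overline{\mathbf x}(t),\overline{\mathbf g}(t,\overline{\mathbf x}(t))\big)+\overline{\mathbf B}(t)\,\overline{\mathbf g}_x(t,\overline{\mathbf x}(t)).$$ Then for all $\mathbf g$ in a neighborhood of $\overline{\mathbf g}$ in $\mathcal G^2$ the problem (1) has a unique solution $\mathbf x(\cdot\,;\mathbf g)\in (W^{1,\infty}(I))^{n_x}$ and the integral in $\widehat q(\mathbf g)$ converges; the adjoint equation $$-\overline{\boldsymbol\lambda}'(t)=\overline{\mathbf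 A}(t)^T\overline{\boldsymbol\lambda}(t)+\nabla_x l\big(t,\overline{\mathbf x}(t),\overline{\mathbf g}(t,\overline{\mathbf x}(t))\big)+\overline{\mathbf g}_x(t,\overline{\mathbf x}(t))^T\nabla_g l\big(t,\overline{\mathbf x}(t),\overline{\mathbf g}(t,\overline{\mathbf x}(t))\big)\ \text{ for a.a. } t\in I,\qquad \overline{\boldsymbol\lambda}(t_f)=\nabla\varphi(\overline{\mathbf x}(t_f)),$$ has a solution $\overline{\boldsymbol\lambda}\in (W^{1,\infty}(I))^{n_x}$; and $\widehat q$ is Fréchet differentiable at $\overline{\mathbf g}$ with, for every such solution $\overline{\boldsymbol\lambda}$ and every $\delta\mathbf g\in\mathcal G^2$, $$\widehat q_{\mathbf g}(\overline{\mathbf g})\,\delta\mathbf g=\int_{t_0}^{t_f}\Big[\overline{\mathbf B}(t)^T\overline{\boldsymbol\lambda}(t)+\nabla_g l\big(t,\overline{\mathbf x}(t),\overline{\mathbf g}(t,\overline{\mathbf x}(t))\big)\Big]^T\delta\mathbf g\big(t,\overline{\mathbf x}(t)\big)\,dt ,$$ the integrand being integrable. -/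

import Mathlib

open MeasureTheory Set Filter Topology
open scoped ENNReal

namespace ODESensitivity

/-- The space of column vectors with `n` real entries. -/
abbrev Vec (n : ℕ) := EuclideanSpace ℝ (Fin n)

/-- Lebesgue measure on the open interval `I = (t0, tf)`. -/
noncomputable abbrev intervalMeasure (t0 tf : ℝ) : Measure ℝ := volume.restrict (Ioo t0 tf)

/-! ### The space of component functions -/

/-- `ess sup_{t ∈ I} sup_x ‖g⁽ⁿ⁾(t, x)‖`, where `g⁽ⁿ⁾` is the `n`-th derivative with respect to `x`. -/
noncomputable def derivEssSup (t0 tf : ℝ) {nx ng : ℕ} (n : ℕ) (g : ℝ → Vec nx → Vec ng) : ℝ≥0∞ :=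
  essSup (fun t => ⨆ x, ‖iteratedFDeriv ℝ n (g t) x‖ₑ) (intervalMeasure t0 tf)

/-- The extended-real valued norm of order `k`: the sum of the above over the orders `0, …, k`. -/
noncomputable def componentENorm (t0 tf : ℝ) {nx ng : ℕ} (k : ℕ) (g : ℝ → Vec nx → Vec ng) :
    ℝ≥0∞ :=
  ∑ n ∈ Finset.range (k + 1), derivEssSup t0 tf n g

/-- Membership in the space of component functions of order `k`: `k` times continuously
differentiable in `x` for almost all `t`, measurable in `t` for each `x`, of finite norm.
Functions are total in `t`, but only their values for `t ∈ I` enter. -/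
structure IsComponent (t0 tf : ℝ) {nx ng : ℕ} (k : ℕ) (g : ℝ → Vec nx → Vec ng) : Prop where
  contDiff : ∀ᵐ t ∂intervalMeasure t0 tf, ContDiff ℝ (k : ℕ∞) (g t)
  measurable : ∀ x, AEStronglyMeasurable (fun t => g t x) (intervalMeasure t0 tf)
  finite : componentENorm t0 tf k g < ∞

section
variable {t0 tf : ℝ} {nx ng k : ℕ}

theorem derivEssSup_add_le {n : ℕ} (hn : n ≤ k) {g h : ℝ → Vec nx → Vec ng}
    (hg : ∀ᵐ t ∂intervalMeasure t0 tf, ContDiff ℝ (k : ℕ∞) (g t))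
    (hh : ∀ᵐ t ∂intervalMeasure t0 tf, ContDiff ℝ (k : ℕ∞) (h t)) :
    derivEssSup t0 tf n (g + h) ≤ derivEssSup t0 tf n g + derivEssSup t0 tf n h := by
  unfold derivEssSup
  refine le_trans (essSup_mono_ae ?_) (ENNReal.essSup_add_le _ _)
  filter_upwards [hg, hh] with t hgt hht
  refine iSup_le fun x => ?_
  have h1 : ContDiffAt ℝ n (g t) x := (hgt.of_le (by exact_mod_cast hn)).contDiffAt
  have h2 : ContDiffAt ℝ n (h t) x := (hht.of_le (by exact_mod_cast hn)).contDiffAt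
  rw [Pi.add_apply g h t, iteratedFDeriv_add_apply h1 h2]
  refine (enorm_add_le _ _).trans ?_
  exact add_le_add (le_iSup (fun x => ‖iteratedFDeriv ℝ n (g t) x‖ₑ) x)
    (le_iSup (fun x => ‖iteratedFDeriv ℝ n (h t) x‖ₑ) x)

theorem derivEssSup_smul {n : ℕ} (hn : n ≤ k) (c : ℝ) {g : ℝ → Vec nx → Vec ng}
    (hg : ∀ᵐ t ∂intervalMeasure t0 tf, ContDiff ℝ (k : ℕ∞) (g t)) :
    derivEssSup t0 tf n (c • g) = ‖c‖ₑ * derivEssSup t0 tf n g := by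
  unfold derivEssSup
  rw [← ENNReal.essSup_const_mul]
  refine essSup_congr_ae ?_
  filter_upwards [hg] with t hgt
  rw [ENNReal.mul_iSup]
  refine iSup_congr fun x => ?_
  have h1 : ContDiffAt ℝ n (g t) x := (hgt.of_le (by exact_mod_cast hn)).contDiffAt
  rw [Pi.smul_apply c g t, iteratedFDeriv_const_smul_apply h1, enorm_smul]

theorem componentENorm_add_le {g h : ℝ → Vec nx → Vec ng}
    (hg : IsComponent t0 tf k g) (hh : IsComponent t0 tf k h) :
    componentENorm t0 tf k (g + h) ≤ componentENorm t0 tf k g + componentENorm t0 tf k h := by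
  unfold componentENorm
  rw [← Finset.sum_add_distrib]
  exact Finset.sum_le_sum fun n hn =>
    derivEssSup_add_le (Nat.lt_succ_iff.mp (Finset.mem_range.mp hn)) hg.contDiff hh.contDiff

theorem componentENorm_smul (c : ℝ) {g : ℝ → Vec nx → Vec ng} (hg : IsComponent t0 tf k g) :
    componentENorm t0 tf k (c • g) = ‖c‖ₑ * componentENorm t0 tf k g := by
  unfold componentENorm
  rw [Finset.mul_sum]
  exact Finset.sum_congr rfl fun n hn =>
    derivEssSup_smul (Nat.lt_succ_iff.mp (Finset.mem_range.mp hn)) c hg.contDiff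

theorem componentENorm_zero : componentENorm t0 tf k (0 : ℝ → Vec nx → Vec ng) = 0 := by
  unfold componentENorm derivEssSup
  refine Finset.sum_eq_zero fun n _ => ?_
  have h : (fun t : ℝ => ⨆ x, ‖iteratedFDeriv ℝ n ((0 : ℝ → Vec nx → Vec ng) t) x‖ₑ)
      = fun _ => (0 : ℝ≥0∞) := by
    funext t
    simp
  rw [h]
  exact le_antisymm (essSup_le_of_ae_le 0 (Eventually.of_forall fun _ => le_rfl)) bot_le

end

/-- The component functions of order `k` form a vector space. -/
def componentSubmodule (t0 tf : ℝ) (nx ng k : ℕ) : Submodule ℝ (ℝ → Vec nx → Vec ng) where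
  carrier := {g | IsComponent t0 tf k g}
  zero_mem' :=
    { contDiff := Eventually.of_forall fun _ => contDiff_const
      measurable := fun _ => aestronglyMeasurable_const
      finite := by rw [componentENorm_zero]; exact ENNReal.zero_lt_top }
  add_mem' := fun {g h} hg hh =>
    { contDiff := by
        filter_upwards [hg.contDiff, hh.contDiff] with t h1 h2
        exact h1.add h2
      measurable := fun x => (hg.measurable x).add (hh.measurable x)
      finite := (componentENorm_add_le hg hh).trans_lt (ENNReal.add_lt_top.2 ⟨hg.finite, hh.finite⟩) }
  smul_mem' := fun c g hg =>
    { contDiff := by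
        filter_upwards [hg.contDiff] with t h1
        exact h1.const_smul c
      measurable := fun x => (hg.measurable x).const_smul c
      finite := by
        rw [componentENorm_smul c hg]
        exact ENNReal.mul_lt_top enorm_lt_top hg.finite }

/-- The space `𝒢ᵏ` of component functions. Its elements are functions, so its norm vanishes exactly
on the functions `g` with `g(t, ·) = 0` for almost all `t ∈ I`; passing to classes of functions
that agree for almost all `t` changes neither the norm nor anything defined below. -/
def ComponentSpace (t0 tf : ℝ) (nx ng k : ℕ) : Type := componentSubmodule t0 tf nx ng k

section
variable {t0 tf : ℝ} {nx ng k : ℕ}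

instance : CoeFun (ComponentSpace t0 tf nx ng k) (fun _ => ℝ → Vec nx → Vec ng) where
  coe g := g.1

instance : AddCommGroup (ComponentSpace t0 tf nx ng k) :=
  inferInstanceAs (AddCommGroup (componentSubmodule t0 tf nx ng k))

instance : Module ℝ (ComponentSpace t0 tf nx ng k) :=
  inferInstanceAs (Module ℝ (componentSubmodule t0 tf nx ng k))

/-- `‖g‖ = ∑_{n ≤ k} ess sup_{t ∈ I} sup_x ‖g⁽ⁿ⁾(t, x)‖`. -/
noncomputable def componentSeminorm (t0 tf : ℝ) (nx ng k : ℕ) :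
    Seminorm ℝ (ComponentSpace t0 tf nx ng k) :=
  Seminorm.of (fun g => (componentENorm t0 tf k g).toReal)
    (fun g h => by
      have h1 := componentENorm_add_le g.2 h.2
      have h2 := ENNReal.toReal_mono (ENNReal.add_ne_top.2 ⟨g.2.finite.ne, h.2.finite.ne⟩) h1
      rwa [ENNReal.toReal_add g.2.finite.ne h.2.finite.ne] at h2)
    (fun c g => by
      have h1 := congrArg ENNReal.toReal (componentENorm_smul c g.2)
      rwa [ENNReal.toReal_mul, toReal_enorm] at h1)

noncomputable instance : SeminormedAddCommGroup (ComponentSpace t0 tf nx ng k) :=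
  (componentSeminorm t0 tf nx ng k).toAddGroupSeminorm.toSeminormedAddCommGroup

theorem ComponentSpace.norm_def (g : ComponentSpace t0 tf nx ng k) :
    ‖g‖ = (componentENorm t0 tf k g).toReal := rfl

noncomputable instance : NormedSpace ℝ (ComponentSpace t0 tf nx ng k) where
  norm_smul_le c g := (map_smul_eq_mul (componentSeminorm t0 tf nx ng k) c g).le

end

/-! ### Assumptions on the dynamics and on the running cost -/

section
variable {nx ng : ℕ} {Y : Type*} [NormedAddCommGroup Y] [NormedSpace ℝ Y]

/-- The partial derivative with respect to `x`. -/
noncomputable def partialX (f : ℝ → Vec nx → Vec ng → Y) (t : ℝ) (x : Vec nx) (g : Vec ng) :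
    Vec nx →L[ℝ] Y :=
  fderiv ℝ (fun y => f t y g) x

/-- The partial derivative with respect to `g`. -/
noncomputable def partialG (f : ℝ → Vec nx → Vec ng → Y) (t : ℝ) (x : Vec nx) (g : Vec ng) :
    Vec ng →L[ℝ] Y :=
  fderiv ℝ (fun h => f t x h) g

/-- Carathéodory function of `(t, (x, g))` with linear growth in `g` at `x = 0` that is locally
Lipschitz in `(x, g)`, uniformly in `t`. -/
structure IsLocallyLipschitzCaratheodory (t0 tf : ℝ) (f : ℝ → Vec nx → Vec ng → Y) : Prop where
  continuous : ∀ᵐ t ∂intervalMeasure t0 tf, Continuous fun p : Vec nx × Vec ng => f t p.1 p.2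
  measurable : ∀ x g, AEStronglyMeasurable (fun t => f t x g) (intervalMeasure t0 tf)
  growth : ∃ K > 0, ∀ᵐ t ∂intervalMeasure t0 tf, ∀ g, ‖f t 0 g‖ ≤ K * (‖g‖ + 1)
  lipschitz : ∀ R > 0, ∃ L : ℝ, ∀ᵐ t ∂intervalMeasure t0 tf,
    ∀ x₁ ∈ Metric.closedBall (0 : Vec nx) R, ∀ x₂ ∈ Metric.closedBall (0 : Vec nx) R,
    ∀ g₁ ∈ Metric.closedBall (0 : Vec ng) R, ∀ g₂ ∈ Metric.closedBall (0 : Vec ng) R,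
      ‖f t x₁ g₁ - f t x₂ g₂‖ ≤ L * (‖x₁ - x₂‖ + ‖g₁ - g₂‖)

/-- In addition: continuously differentiable in `(x, g)`, with partial derivatives of linear growth
in `g` at `x = 0` that are locally Lipschitz in `(x, g)`, uniformly in `t`. -/
structure IsSmoothCaratheodory (t0 tf : ℝ) (f : ℝ → Vec nx → Vec ng → Y) : Prop
    extends IsLocallyLipschitzCaratheodory t0 tf f where
  contDiff : ∀ᵐ t ∂intervalMeasure t0 tf, ContDiff ℝ 1 fun p : Vec nx × Vec ng => f t p.1 p.2
  deriv_growth : ∃ K > 0, ∀ᵐ t ∂intervalMeasure t0 tf, ∀ g,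
    ‖partialX f t 0 g‖ ≤ K * (‖g‖ + 1) ∧ ‖partialG f t 0 g‖ ≤ K * (‖g‖ + 1)
  deriv_lipschitz : ∀ R > 0, ∃ L : ℝ, ∀ᵐ t ∂intervalMeasure t0 tf,
    ∀ x₁ ∈ Metric.closedBall (0 : Vec nx) R, ∀ x₂ ∈ Metric.closedBall (0 : Vec nx) R,
    ∀ g₁ ∈ Metric.closedBall (0 : Vec ng) R, ∀ g₂ ∈ Metric.closedBall (0 : Vec ng) R,
      ‖partialX f t x₁ g₁ - partialX f t x₂ g₂‖ + ‖partialG f t x₁ g₁ - partialG f t x₂ g₂‖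
        ≤ L * (‖x₁ - x₂‖ + ‖g₁ - g₂‖)

end

/-! ### Solutions of the initial value problem and the quantity of interest -/

/-- `x` is (the continuous representative on `[t0, tf]` of) an element of `(W^{1,∞}(I))ⁿ`:
absolutely continuous with essentially bounded derivative. -/
def MemW1Inf (t0 tf : ℝ) {n : ℕ} (x : ℝ → Vec n) : Prop :=
  AbsolutelyContinuousOnInterval x t0 tf ∧ MemLp (deriv x) ∞ (intervalMeasure t0 tf)

section
variable {nx ng : ℕ}

/-- `x ∈ (W^{1,∞}(I))ⁿ` solves `x'(t) = f(t, x(t), g(t, x(t)))` for almost all `t ∈ I`,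
`x(t0) = x0`. -/
structure IsState (t0 tf : ℝ) (f : ℝ → Vec nx → Vec ng → Vec nx) (x0 : Vec nx)
    (g : ℝ → Vec nx → Vec ng) (x : ℝ → Vec nx) : Prop where
  memW1Inf : MemW1Inf t0 tf x
  initial : x t0 = x0
  ode : ∀ᵐ t ∂intervalMeasure t0 tf, HasDerivAt x (f t (x t) (g t (x t))) t

open Classical in
/-- The state `x(· ; g)`: a solution of the initial value problem if there is one
(and the zero function otherwise). -/
noncomputable def stateOf (t0 tf : ℝ) (f : ℝ → Vec nx → Vec ng → Vec nx) (x0 : Vec nx)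
    (g : ℝ → Vec nx → Vec ng) : ℝ → Vec nx :=
  if h : ∃ x, IsState t0 tf f x0 g x then h.choose else 0

/-- `q(x, g) = φ(x(tf)) + ∫ l(t, x(t), g(t, x(t))) dt`. -/
noncomputable def qoi (t0 tf : ℝ) (φ : Vec nx → ℝ) (l : ℝ → Vec nx → Vec ng → ℝ)
    (x : ℝ → Vec nx) (g : ℝ → Vec nx → Vec ng) : ℝ :=
  φ (x tf) + ∫ t in t0..tf, l t (x t) (g t (x t))

/-- The reduced quantity of interest `q̂(g) = q(x(· ; g), g)` on the space of component functions
of order two. -/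
noncomputable def reducedQoi (t0 tf : ℝ) (f : ℝ → Vec nx → Vec ng → Vec nx) (x0 : Vec nx)
    (φ : Vec nx → ℝ) (l : ℝ → Vec nx → Vec ng → ℝ) (g : ComponentSpace t0 tf nx ng 2) : ℝ :=
  qoi t0 tf φ l (stateOf t0 tf f x0 g) g

/-! ### Linearization along a trajectory and the adjoint equation -/

/-- The Jacobian `g_x(t, x(t))`. -/
noncomputable def jacobianAlong (g : ℝ → Vec nx → Vec ng) (x : ℝ → Vec nx) (t : ℝ) :
    Vec nx →L[ℝ] Vec ng :=
  fderiv ℝ (g t) (x t)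

/-- `B(t) = f_g(t, x(t), g(t, x(t)))`. -/
noncomputable def matB (f : ℝ → Vec nx → Vec ng → Vec nx) (g : ℝ → Vec nx → Vec ng)
    (x : ℝ → Vec nx) (t : ℝ) : Vec ng →L[ℝ] Vec nx :=
  partialG f t (x t) (g t (x t))

/-- `A(t) = f_x(t, x(t), g(t, x(t))) + f_g(t, x(t), g(t, x(t))) g_x(t, x(t))`. -/
noncomputable def matA (f : ℝ → Vec nx → Vec ng → Vec nx) (g : ℝ → Vec nx → Vec ng)
    (x : ℝ → Vec nx) (t : ℝ) : Vec nx →L[ℝ] Vec nx :=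
  partialX f t (x t) (g t (x t)) + (matB f g x t).comp (jacobianAlong g x t)

/-- The gradient `∇_x l(t, x(t), g(t, x(t)))`. -/
noncomputable def gradXAlong (l : ℝ → Vec nx → Vec ng → ℝ) (g : ℝ → Vec nx → Vec ng)
    (x : ℝ → Vec nx) (t : ℝ) : Vec nx :=
  gradient (fun y => l t y (g t (x t))) (x t)

/-- The gradient `∇_g l(t, x(t), g(t, x(t)))`. -/
noncomputable def gradGAlong (l : ℝ → Vec nx → Vec ng → ℝ) (g : ℝ → Vec nx → Vec ng)
    (x : ℝ → Vec nx) (t : ℝ) : Vec ng :=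
  gradient (fun h => l t (x t) h) (g t (x t))

/-- `lam ∈ (W^{1,∞}(I))ⁿ` solves the adjoint equation
`-lam'(t) = A(t)ᵀ lam(t) + ∇_x l + g_x(t, x(t))ᵀ ∇_g l` for almost all `t ∈ I`,
`lam(tf) = ∇φ(x(tf))`. -/
structure IsAdjointState (t0 tf : ℝ) (f : ℝ → Vec nx → Vec ng → Vec nx)
    (φ : Vec nx → ℝ) (l : ℝ → Vec nx → Vec ng → ℝ)
    (g : ℝ → Vec nx → Vec ng) (x lam : ℝ → Vec nx) : Prop where
  memW1Inf : MemW1Inf t0 tf lam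
  terminal : lam tf = gradient φ (x tf)
  ode : ∀ᵐ t ∂intervalMeasure t0 tf, HasDerivAt lam
    (-(ContinuousLinearMap.adjoint (matA f g x t) (lam t) + gradXAlong l g x t
      + ContinuousLinearMap.adjoint (jacobianAlong g x t) (gradGAlong l g x t))) t

end

end ODESensitivity

/-! Write δx = x − x̄ and δg = g − ḡ for a nearby `g` with state `x`. The adjoint state λ is
designed so that the first-order influence of δx cancels: the derivative of ⟨λ, δx⟩ plus the
increment of the running cost equals the sensitivity integrand in direction δg, up to K(‖δx‖ +
‖δg‖)² (`exists_adjoint_remainder_bound`). Integrating over the interval, the boundary term at `t0`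
vanishes because both states start at `x0`, and the one at `tf` is φ'(x̄(tf)) δx(tf). Grönwall gives
‖δx‖ ≤ C‖δg‖, so the remainder is quadratic in ‖δg‖ (`exists_reducedQoi_remainder_bound`), and
differentiability of φ at x̄(tf) finishes the argument. The linearized state equation is never
solved.

The remainder is quadratic for two reasons, both in `HasLocalBounds.norm_comp_taylor_le`: the
`x`-derivatives of ḡ and the partial derivatives of `f` and `l` are Lipschitz, and δg is itself
Lipschitz in `x` with constant ‖δg‖, so δg(t, x) − δg(t, x̄) is at most ‖δg‖‖δx‖.

Existence near ḡ (`IsState.exists_nearby`) must cope with an `f` that is only locally Lipschitz. The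
field is composed with the retraction onto a ball, the resulting globally Lipschitz equation is
solved by `exists_caratheodory_solution`, and Grönwall keeps the solution close to x̄, where the
retraction is the identity. The adjoint equation is affine in λ, so the same existence theorem with
time reversed solves it directly. -/

namespace ODESensitivity

/-! ### Measurability and primitives on the interval -/

section Analysis

variable {t0 tf : ℝ} {E : Type*} [NormedAddCommGroup E]

theorem ae_Ioc_of_ae_intervalMeasure {P : ℝ → Prop} (h : ∀ᵐ t ∂intervalMeasure t0 tf, P t) :
    ∀ᵐ t, t ∈ Ioc t0 tf → P t := by
  rw [intervalMeasure, restrict_Ioo_eq_restrict_Ioc] at h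
  exact (ae_restrict_iff' measurableSet_Ioc).1 h

theorem ae_intervalMeasure_mem : ∀ᵐ t ∂intervalMeasure t0 tf, t ∈ Ioo t0 tf :=
  ae_restrict_mem measurableSet_Ioo

/-- Superposition of a Carathéodory function with a measurable function. -/
theorem aestronglyMeasurable_caratheodory_comp {α : Type*} [MeasurableSpace α] {μ : Measure α}
    {Z W : Type*} [TopologicalSpace Z] [NormedAddCommGroup W] {u : α → Z → W}
    (hu : ∀ᵐ t ∂μ, Continuous (u t)) (hm : ∀ z, AEStronglyMeasurable (fun t => u t z) μ)
    {v : α → Z} (hv : AEStronglyMeasurable v μ) :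
    AEStronglyMeasurable (fun t => u t (v t)) μ := by
  classical
  -- On each fibre of a simple function the superposition is one of the sections u(·, c). A general
  -- `v` is a pointwise limit of simple functions, and continuity of u(t, ·) passes to that limit.
  have hs : ∀ s : SimpleFunc α Z, AEStronglyMeasurable (fun t => u t (s t)) μ := by
    intro s
    have h : (fun t => u t (s t)) =
        fun t => ∑ c ∈ s.range, (s ⁻¹' {c}).indicator (fun t => u t c) t := by
      funext t
      rw [Finset.sum_eq_single_of_mem (s t) (s.mem_range_self t)]
      · simp
      · intro b _ hb
        exact indicator_of_notMem (fun h => hb h.symm) _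
    rw [h]
    exact Finset.aestronglyMeasurable_fun_sum _ fun c _ =>
      (hm c).indicator (s.measurableSet_fiber c)
  refine aestronglyMeasurable_of_tendsto_ae atTop
    (fun n => hs (hv.stronglyMeasurable_mk.approx n)) ?_
  filter_upwards [hu, hv.ae_eq_mk] with t h1 h2
  rw [h2]
  exact (h1.tendsto _).comp (hv.stronglyMeasurable_mk.tendsto_approx t)

theorem intervalIntegrable_of_ae_bounded (ht : t0 ≤ tf) {h : ℝ → E} {C : ℝ}
    (hm : AEStronglyMeasurable h (intervalMeasure t0 tf))
    (hb : ∀ᵐ t ∂intervalMeasure t0 tf, ‖h t‖ ≤ C) : IntervalIntegrable h volume t0 tf := by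
  rw [intervalIntegrable_iff_integrableOn_Ioo_of_le ht]
  have : IsFiniteMeasure (intervalMeasure t0 tf) := ⟨by simp [intervalMeasure]⟩
  exact Integrable.of_bound hm C hb

theorem norm_integral_le_of_ae_bounded [NormedSpace ℝ E] (ht : t0 ≤ tf) {h : ℝ → E} {C : ℝ}
    (hb : ∀ᵐ t ∂intervalMeasure t0 tf, ‖h t‖ ≤ C) :
    ‖∫ t in t0..tf, h t‖ ≤ C * (tf - t0) := by
  rw [← abs_of_nonneg (sub_nonneg.2 ht)]
  refine intervalIntegral.norm_integral_le_of_norm_le_const_ae ?_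
  rw [uIoc_of_le ht]
  exact ae_Ioc_of_ae_intervalMeasure hb

theorem lipschitzOnWith_primitive [NormedSpace ℝ E] (ht : t0 ≤ tf) {h : ℝ → E} {C : ℝ}
    (hm : AEStronglyMeasurable h (intervalMeasure t0 tf))
    (hb : ∀ᵐ t ∂intervalMeasure t0 tf, ‖h t‖ ≤ C) :
    LipschitzOnWith C.toNNReal (fun t => ∫ s in t0..t, h s) (Icc t0 tf) := by
  have hi := intervalIntegrable_of_ae_bounded ht hm hb
  have hsub : ∀ t ∈ Icc t0 tf, IntervalIntegrable h volume t0 t := fun t h =>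
    hi.mono_set (by rw [uIcc_of_le ht, uIcc_of_le h.1]; exact Icc_subset_Icc_right h.2)
  refine LipschitzOnWith.of_dist_le_mul fun s hs t htm => ?_
  rw [dist_eq_norm, intervalIntegral.integral_interval_sub_left (hsub s hs) (hsub t htm),
    Real.dist_eq]
  refine (intervalIntegral.norm_integral_le_of_norm_le_const_ae (C := C) ?_).trans ?_
  · filter_upwards [ae_Ioc_of_ae_intervalMeasure hb] with r hr hr'
    refine hr ?_
    rw [mem_uIoc] at hr'
    rcases hr' with h' | h'
    · exact ⟨htm.1.trans_lt h'.1, h'.2.trans hs.2⟩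
    · exact ⟨hs.1.trans_lt h'.1, h'.2.trans htm.2⟩
  · gcongr
    exact Real.le_coe_toNNReal C

theorem ae_hasDerivAt_primitive [NormedSpace ℝ E] [CompleteSpace E] (ht : t0 ≤ tf) {h : ℝ → E}
    (hi : IntervalIntegrable h volume t0 tf) :
    ∀ᵐ t ∂intervalMeasure t0 tf, HasDerivAt (fun t => ∫ s in t0..t, h s) (h t) t := by
  refine (ae_restrict_iff' measurableSet_Ioo).2 ?_
  filter_upwards [hi.ae_hasDerivAt_integral] with t h1 h2
  rw [uIcc_of_le ht] at h1
  exact h1 ⟨h2.1.le, h2.2.le⟩ t0 (left_mem_Icc.2 ht)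

/-- The fundamental theorem of calculus for absolutely continuous vector-valued functions with
essentially bounded derivative. -/
theorem eq_add_integral_of_absolutelyContinuous [NormedSpace ℝ E] [CompleteSpace E] (ht : t0 ≤ tf) {x h : ℝ → E}
    {C : ℝ} (hac : AbsolutelyContinuousOnInterval x t0 tf)
    (hd : ∀ᵐ t ∂intervalMeasure t0 tf, HasDerivAt x (h t) t)
    (hb : ∀ᵐ t ∂intervalMeasure t0 tf, ‖h t‖ ≤ C) :
    IntervalIntegrable h volume t0 tf ∧ ∀ t ∈ Icc t0 tf, x t = x t0 + ∫ s in t0..t, h s := by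
  have hm : AEStronglyMeasurable h (intervalMeasure t0 tf) :=
    (aestronglyMeasurable_deriv x _).congr (hd.mono fun t h => h.deriv)
  have hi := intervalIntegrable_of_ae_bounded ht hm hb
  have hL := lipschitzOnWith_primitive ht hm hb
  rw [← uIcc_of_le ht] at hL
  -- The difference between `x` and the primitive of `h` has zero derivative almost everywhere.
  -- Absolute continuity is what makes it constant; a Cantor function shows that the derivative
  -- alone would not.
  have hac2 := hac.sub hL.absolutelyContinuousOnInterval
  have hz : ∀ᵐ t, t ∈ uIcc t0 tf → HasDerivAt (x - fun t => ∫ s in t0..t, h s) 0 t := by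
    have h1 : ∀ᵐ t ∂intervalMeasure t0 tf,
        HasDerivAt (x - fun t => ∫ s in t0..t, h s) 0 t := by
      filter_upwards [hd, ae_hasDerivAt_primitive ht hi] with t h1 h2
      simpa using h1.sub h2
    rw [intervalMeasure, restrict_Ioo_eq_restrict_Icc] at h1
    rw [uIcc_of_le ht]
    exact (ae_restrict_iff' measurableSet_Icc).1 h1
  obtain ⟨c, hc⟩ := hac2.const_of_ae_hasDerivAt_zero hz
  rw [uIcc_of_le ht] at hc
  refine ⟨hi, fun t htm => ?_⟩
  have h1 := hc t htm
  have h2 := hc t0 (left_mem_Icc.2 ht)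
  simp only [Pi.sub_apply, intervalIntegral.integral_same, sub_zero] at h1 h2
  rw [h2, ← h1, sub_add_cancel]

theorem exists_norm_le_of_absolutelyContinuous (ht : t0 ≤ tf) {x : ℝ → E}
    (hac : AbsolutelyContinuousOnInterval x t0 tf) :
    ∃ ρ, 0 ≤ ρ ∧ ∀ t ∈ Icc t0 tf, ‖x t‖ ≤ ρ := by
  obtain ⟨C, hC⟩ := hac.exists_bound
  rw [uIcc_of_le ht] at hC
  exact ⟨max C 0, le_max_right _ _, fun t h => (hC t h).trans (le_max_left _ _)⟩

theorem aestronglyMeasurable_of_absolutelyContinuous (ht : t0 ≤ tf) {x : ℝ → E}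
    (hac : AbsolutelyContinuousOnInterval x t0 tf) :
    AEStronglyMeasurable x (intervalMeasure t0 tf) := by
  have h := hac.continuousOn
  rw [uIcc_of_le ht] at h
  exact (h.mono Ioo_subset_Icc_self).aestronglyMeasurable measurableSet_Ioo

/-- Grönwall's inequality for an absolutely continuous function vanishing at `t0`. -/
theorem norm_le_of_norm_hasDerivAt_le [NormedSpace ℝ E] [CompleteSpace E] (ht : t0 ≤ tf) {x h : ℝ → E} {a b : ℝ}
    (ha : 0 ≤ a) (hb : 0 < b)
    (hac : AbsolutelyContinuousOnInterval x t0 tf) (h0 : x t0 = 0)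
    (hd : ∀ᵐ t ∂intervalMeasure t0 tf, HasDerivAt x (h t) t)
    (hbd : ∀ᵐ t ∂intervalMeasure t0 tf, ‖h t‖ ≤ a + b * ‖x t‖) :
    ∀ t ∈ Icc t0 tf, ‖x t‖ ≤ a * ((tf - t0) * Real.exp (b * (tf - t0))) := by
  obtain ⟨ρ, hρ0, hρ⟩ := exists_norm_le_of_absolutelyContinuous ht hac
  have hb' : ∀ᵐ t ∂intervalMeasure t0 tf, ‖h t‖ ≤ a + b * ρ := by
    filter_upwards [hbd, ae_intervalMeasure_mem] with t h1 h2
    refine h1.trans ?_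
    gcongr
    exact hρ t ⟨h2.1.le, h2.2.le⟩
  obtain ⟨-, hx⟩ := eq_add_integral_of_absolutelyContinuous ht hac hd hb'
  have hcont : ContinuousOn (fun t => ‖x t‖) (Icc t0 tf) := by
    have := hac.continuousOn
    rw [uIcc_of_le ht] at this
    exact this.norm
  -- Extending ‖x‖ by its endpoint values gives a continuous function on the whole line, so its
  -- primitive is differentiable everywhere.
  set V : ℝ → ℝ := fun t => ‖x (projIcc t0 tf ht t)‖ with hV
  have hVc : Continuous V := by
    have := continuousOn_iff_continuous_domRestrict.1 hcont
    exact this.comp continuous_projIcc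
  have hVe : ∀ t ∈ Icc t0 tf, V t = ‖x t‖ := fun t h => by
    simp only [hV, projIcc_of_mem ht h]
  have hint : ∀ t ∈ Icc t0 tf, ‖x t‖ ≤ a * (tf - t0) + b * ∫ s in t0..t, V s := by
    intro t htm
    rw [hx t htm, h0, zero_add]
    have h1 : ‖∫ s in t0..t, h s‖ ≤ ∫ s in t0..t, (a + b * V s) := by
      refine intervalIntegral.norm_integral_le_of_norm_le htm.1 ?_
        (Continuous.intervalIntegrable (by fun_prop) _ _)
      filter_upwards [ae_Ioc_of_ae_intervalMeasure hbd] with s hs hs'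
      rw [hVe s ⟨hs'.1.le, hs'.2.trans htm.2⟩]
      exact hs ⟨hs'.1, hs'.2.trans htm.2⟩
    rw [intervalIntegral.integral_add (by simp) ((hVc.const_mul b).intervalIntegrable _ _),
      intervalIntegral.integral_const_mul, intervalIntegral.integral_const, smul_eq_mul] at h1
    refine h1.trans ?_
    rw [mul_comm a]
    gcongr
    exact htm.2
  -- The differential Grönwall inequality needs a derivative at every point. It is therefore applied
  -- to the primitive U of `V`, which satisfies U' ≤ bU + a(tf − t0), and not to ‖x‖ itself.
  have hU : ∀ t ∈ Icc t0 tf, ‖∫ s in t0..t, V s‖ ≤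
      gronwallBound 0 b (a * (tf - t0)) (t - t0) := by
    refine norm_le_gronwallBound_of_norm_deriv_right_le (f' := V) ?_ ?_ ?_ ?_
    · exact (intervalIntegral.continuous_primitive (fun _ _ => hVc.intervalIntegrable _ _)
        t0).continuousOn
    · intro t _
      exact (hVc.integral_hasStrictDerivAt t0 t).hasDerivAt.hasDerivWithinAt
    · simp
    · intro t htm
      have h1 : 0 ≤ ∫ s in t0..t, V s :=
        intervalIntegral.integral_nonneg htm.1 fun s _ => norm_nonneg _
      have h2 : ‖V t‖ = ‖x t‖ := by rw [hVe t ⟨htm.1, htm.2.le⟩, norm_norm]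
      rw [h2, Real.norm_of_nonneg h1, add_comm]
      exact hint t ⟨htm.1, htm.2.le⟩
  intro t htm
  have h1 := (le_abs_self _).trans (hU t htm)
  rw [gronwallBound_of_K_ne_0 hb.ne'] at h1
  calc ‖x t‖ ≤ a * (tf - t0) + b * ∫ s in t0..t, V s := hint t htm
    _ ≤ a * (tf - t0) + b * (0 * Real.exp (b * (t - t0)) +
        a * (tf - t0) / b * (Real.exp (b * (t - t0)) - 1)) := by gcongr
    _ = a * ((tf - t0) * Real.exp (b * (t - t0))) := by field_simp; ring
    _ ≤ _ := by
      have : 0 ≤ tf - t0 := sub_nonneg.2 ht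
      gcongr
      exact htm.2

theorem memW1Inf_of_lipschitzOnWith (ht : t0 ≤ tf) {n : ℕ} {x : ℝ → Vec n} {K : NNReal}
    (h : LipschitzOnWith K x (Icc t0 tf)) : MemW1Inf t0 tf x := by
  refine ⟨LipschitzOnWith.absolutelyContinuousOnInterval (K := K) (by rwa [uIcc_of_le ht]), ?_⟩
  refine memLp_top_of_bound (aestronglyMeasurable_deriv x _) K ?_
  filter_upwards [ae_intervalMeasure_mem] with t htm
  exact norm_deriv_le_of_lipschitzOn (Icc_mem_nhds htm.1 htm.2) h

end Analysis

/-! ### Ball retraction and existence for globally Lipschitz Carathéodory equations. -/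

/-- Nearest-point retraction onto a ball of a Hilbert space. -/
theorem exists_ball_retraction {E : Type*} [NormedAddCommGroup E] [InnerProductSpace ℝ E]
    [CompleteSpace E] {R : ℝ} (hR : 0 ≤ R) :
    ∃ P : E → E, (∀ x y, ‖P x - P y‖ ≤ ‖x - y‖) ∧ (∀ x, ‖P x‖ ≤ R) ∧
      ∀ x, ‖x‖ ≤ R → P x = x := by
  have hconv : Convex ℝ (Metric.closedBall (0 : E) R) := convex_closedBall 0 R
  have h1 := exists_norm_eq_iInf_of_complete_convex
    (K := Metric.closedBall (0 : E) R) ⟨0, by simpa using hR⟩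
    Metric.isClosed_closedBall.isComplete hconv
  choose P hP hPn using h1
  have hvar : ∀ x, ∀ w ∈ Metric.closedBall (0 : E) R, inner ℝ (x - P x) (w - P x) ≤ 0 :=
    fun x => (norm_eq_iInf_iff_real_inner_le_zero hconv (hP x)).1 (hPn x)
  refine ⟨P, fun x y => ?_, fun x => by simpa using hP x, fun x hx => ?_⟩
  · have h1 := hvar x (P y) (hP y)
    have h2 := hvar y (P x) (hP x)
    -- The sum of the two variational inequalities; Cauchy–Schwarz then makes the projection
    -- nonexpansive.
    have h3 : ‖P x - P y‖ ^ 2 ≤ inner ℝ (x - y) (P x - P y) := by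
      rw [← real_inner_self_eq_norm_sq]
      have e1 : inner ℝ (x - P x) (P y - P x) = - inner ℝ (x - P x) (P x - P y) := by
        rw [← inner_neg_right, neg_sub]
      have e2 : inner ℝ (x - y) (P x - P y) = inner ℝ (x - P x) (P x - P y)
          + inner ℝ (P x - P y) (P x - P y) - inner ℝ (y - P y) (P x - P y) := by
        rw [← inner_add_left, ← inner_sub_left]
        congr 1
        abel
      linarith
    have h4 := real_inner_le_norm (x - y) (P x - P y)
    rcases (norm_nonneg (P x - P y)).eq_or_lt with h | h
    · rw [← h]; exact norm_nonneg _
    · nlinarith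
  · have h1 := hvar x x (by simpa using hx)
    have h2 : inner ℝ (x - P x) (x - P x) = 0 := le_antisymm h1 real_inner_self_nonneg
    exact (sub_eq_zero.1 (inner_self_eq_zero.1 h2)).symm

/-- Global existence for a Carathéodory differential equation whose right-hand side is globally
Lipschitz. -/
theorem exists_caratheodory_solution {E : Type*} [NormedAddCommGroup E] [NormedSpace ℝ E]
    [CompleteSpace E] {t0 tf : ℝ} (ht : t0 ≤ tf) {F : ℝ → E → E} {L M : ℝ} (hL : 0 ≤ L)
    (hm : ∀ x, AEStronglyMeasurable (fun t => F t x) (intervalMeasure t0 tf))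
    (hlip : ∀ᵐ t ∂intervalMeasure t0 tf, ∀ x y, ‖F t x - F t y‖ ≤ L * ‖x - y‖)
    (hM : ∀ᵐ t ∂intervalMeasure t0 tf, ‖F t 0‖ ≤ M) (x0 : E) :
    ∃ (x : ℝ → E) (K : NNReal), LipschitzOnWith K x (Icc t0 tf) ∧ x t0 = x0 ∧
      ∀ᵐ t ∂intervalMeasure t0 tf, HasDerivAt x (F t (x t)) t := by
  -- Bielecki weight: with unknown y = e^{−c(t−t0)}x in the sup norm, the Picard map has Lipschitz
  -- constant at most L/c ≤ 1/2 on the whole interval, so no subdivision is needed. The summand 1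
  -- keeps `c` positive when L = 0.
  set c : ℝ := 2 * L + 1 with hc
  have hc0 : 0 < c := by positivity
  set w : ℝ → ℝ := fun t => Real.exp (c * (t - t0)) with hw
  have hw0 : ∀ t, 0 < w t := fun t => Real.exp_pos _
  have hwc : Continuous w := by fun_prop
  have hwd : ∀ t, HasDerivAt (fun t => w t / c) (w t) t := by
    intro t
    have h1 : HasDerivAt (fun t => c * (t - t0)) (c * 1) t :=
      ((hasDerivAt_id t).sub_const t0).const_mul c
    have h2 := h1.exp.div_const c
    rwa [mul_one, mul_div_assoc, div_self hc0.ne', mul_one] at h2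
  let z : C(Icc t0 tf, E) → ℝ → E := fun y s => w s • IccExtend ht y s
  have hzc : ∀ y, Continuous (z y) := fun y => hwc.smul (y.continuous.Icc_extend')
  have hFc : ∀ᵐ t ∂intervalMeasure t0 tf, Continuous (F t) := by
    filter_upwards [hlip] with t h
    exact (LipschitzWith.of_dist_le_mul (K := L.toNNReal) fun x y => by
      rw [dist_eq_norm, dist_eq_norm, Real.coe_toNNReal L hL]; exact h x y).continuous
  have hNm : ∀ y, AEStronglyMeasurable (fun t => F t (z y t)) (intervalMeasure t0 tf) :=
    fun y => aestronglyMeasurable_caratheodory_comp hFc hm (hzc y).aestronglyMeasurable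
  have hNb : ∀ y, ∀ᵐ t ∂intervalMeasure t0 tf, ‖F t (z y t)‖ ≤ M + L * (w tf * ‖y‖) := by
    intro y
    filter_upwards [hlip, hM, ae_intervalMeasure_mem] with t h1 h2 h3
    have h4 : ‖z y t‖ ≤ w tf * ‖y‖ := by
      simp only [z]
      rw [norm_smul, Real.norm_of_nonneg (hw0 t).le]
      gcongr
      · exact Real.exp_le_exp.2 (by nlinarith [h3.2])
      · exact y.norm_coe_le_norm _
    have h5 := h1 (z y t) 0
    rw [sub_zero] at h5
    calc ‖F t (z y t)‖ ≤ ‖F t 0‖ + ‖F t (z y t) - F t 0‖ := norm_le_insert' _ _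
      _ ≤ _ := by gcongr; exact h5.trans (by gcongr)
  have hprim := fun y => lipschitzOnWith_primitive ht (hNm y) (hNb y)
  let T : C(Icc t0 tf, E) → C(Icc t0 tf, E) := fun y =>
    ⟨fun t => (w t)⁻¹ • (x0 + ∫ s in t0..t, F s (z y s)), by
      refine Continuous.smul ((hwc.comp continuous_subtype_val).inv₀ fun t => (hw0 t).ne') ?_
      exact continuous_const.add (continuousOn_iff_continuous_domRestrict.1 (hprim y).continuousOn)⟩
  have hint : ∀ y, ∀ t ∈ Icc t0 tf, IntervalIntegrable (fun s => F s (z y s)) volume t0 t :=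
    fun y t h => (intervalIntegrable_of_ae_bounded ht (hNm y) (hNb y)).mono_set
      (by rw [uIcc_of_le ht, uIcc_of_le h.1]; exact Icc_subset_Icc_right h.2)
  have hT : ContractingWith (1 / 2) T := by
    refine ⟨by rw [← NNReal.coe_lt_coe]; norm_num, LipschitzWith.of_dist_le_mul fun y y' => ?_⟩
    rw [ContinuousMap.dist_le (by positivity)]
    intro t
    obtain ⟨t, htm⟩ := t
    simp only [T, ContinuousMap.coe_mk]
    rw [dist_eq_norm, ← smul_sub, norm_smul, norm_inv, Real.norm_of_nonneg (hw0 t).le,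
      add_sub_add_left_eq_sub, ← intervalIntegral.integral_sub (hint y t htm) (hint y' t htm)]
    have h1 : ‖∫ s in t0..t, (F s (z y s) - F s (z y' s))‖ ≤
        ∫ s in t0..t, L * dist y y' * w s := by
      refine intervalIntegral.norm_integral_le_of_norm_le htm.1 ?_
        ((hwc.const_mul _).intervalIntegrable _ _)
      filter_upwards [ae_Ioc_of_ae_intervalMeasure hlip] with s hs hs'
      refine (hs ⟨hs'.1, hs'.2.trans htm.2⟩ _ _).trans ?_
      rw [mul_assoc]
      gcongr
      simp only [z]
      rw [← smul_sub, norm_smul, Real.norm_of_nonneg (hw0 s).le, mul_comm]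
      gcongr
      rw [← dist_eq_norm]
      exact ContinuousMap.dist_apply_le_dist _
    rw [intervalIntegral.integral_const_mul,
      intervalIntegral.integral_eq_sub_of_hasDerivAt (fun s _ => hwd s)
        (hwc.intervalIntegrable _ _)] at h1
    have h2 : w t0 = 1 := by simp [hw]
    rw [h2] at h1
    have hwt := hw0 t
    calc (w t)⁻¹ * _ ≤ (w t)⁻¹ * (L * dist y y' * (w t / c - 1 / c)) := by gcongr
      _ ≤ (w t)⁻¹ * (L * dist y y' * (w t / c)) := by
        gcongr
        have : 0 < 1 / c := by positivity
        linarith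
      _ = L / c * dist y y' := by field_simp
      _ ≤ _ := by
        gcongr
        rw [div_le_iff₀ hc0]
        push_cast
        rw [hc]
        linarith
  have : Nonempty C(Icc t0 tf, E) := ⟨0⟩
  obtain ⟨y, hy⟩ : ∃ y, T y = y := ⟨_, hT.fixedPoint_isFixedPt⟩
  have hfix : ∀ t ∈ Icc t0 tf, z y t = x0 + ∫ s in t0..t, F s (z y s) := by
    intro t htm
    have h1 := congrArg (fun u : C(Icc t0 tf, E) => u ⟨t, htm⟩) hy
    simp only [T, ContinuousMap.coe_mk] at h1
    simp only [z]
    rw [IccExtend_of_mem ht _ htm, ← h1, smul_smul, mul_inv_cancel₀ (hw0 t).ne', one_smul]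
  refine ⟨fun t => x0 + ∫ s in t0..t, F s (z y s),
    (M + L * (w tf * ‖y‖)).toNNReal, ?_, by simp, ?_⟩
  · refine LipschitzOnWith.of_dist_le_mul fun s hs t ht' => ?_
    rw [dist_add_left]
    exact (hprim y).dist_le_mul s hs t ht'
  · filter_upwards [ae_hasDerivAt_primitive ht
      (intervalIntegrable_of_ae_bounded ht (hNm y) (hNb y)), ae_intervalMeasure_mem] with t h1 h2
    rw [← hfix t ⟨h2.1.le, h2.2.le⟩]
    exact h1.const_add x0

/-! ### Pointwise bounds for component functions. -/

section Components

variable {t0 tf : ℝ} {nx ng : ℕ}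

/-- Uniform bounds for a function of `x` and for its derivatives of order one and two. -/
structure HasC2Bound (u : Vec nx → Vec ng) (M : ℝ) : Prop where
  differentiable : Differentiable ℝ u
  bound : ∀ x, ‖u x‖ ≤ M
  bound_fderiv : ∀ x, ‖fderiv ℝ u x‖ ≤ M
  lipschitz_fderiv : ∀ x y, ‖fderiv ℝ u x - fderiv ℝ u y‖ ≤ M * ‖x - y‖

theorem HasC2Bound.lipschitz {u : Vec nx → Vec ng} {M : ℝ} (h : HasC2Bound u M) (x y : Vec nx) :
    ‖u x - u y‖ ≤ M * ‖x - y‖ :=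
  convex_univ.norm_image_sub_le_of_norm_fderiv_le (fun z _ => h.differentiable z)
    (fun z _ => h.bound_fderiv z) (mem_univ y) (mem_univ x)

/-- On the segment from `y` to `x` the derivative differs from its value at `y` by at most M‖x − y‖;
the mean value inequality then yields the constant `M`, without the sharp factor 1/2. -/
theorem HasC2Bound.taylor {u : Vec nx → Vec ng} {M : ℝ} (hM : 0 ≤ M) (h : HasC2Bound u M)
    (x y : Vec nx) : ‖u x - u y - fderiv ℝ u y (x - y)‖ ≤ M * ‖x - y‖ ^ 2 := by
  rw [pow_two, ← mul_assoc]
  refine (convex_segment y x).norm_image_sub_le_of_norm_fderiv_le'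
    (fun z _ => h.differentiable z) (fun z hz => ?_) (left_mem_segment ℝ y x)
    (right_mem_segment ℝ y x)
  refine (h.lipschitz_fderiv z y).trans ?_
  gcongr
  simpa [norm_sub_rev] using norm_sub_le_of_mem_segment hz

/-- Because the supremum over `x` stands inside the essential supremum, a single null set of times
serves all `x`. This permits later evaluation along arbitrary trajectories. -/
theorem ComponentSpace.derivEssSup_le_norm {k : ℕ} (g : ComponentSpace t0 tf nx ng k) {n : ℕ}
    (hn : n ≤ k) : ∀ᵐ t ∂intervalMeasure t0 tf, ∀ x, ‖iteratedFDeriv ℝ n (g t) x‖ ≤ ‖g‖ := by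
  filter_upwards [ENNReal.ae_le_essSup (μ := intervalMeasure t0 tf)
    (fun t => ⨆ x, ‖iteratedFDeriv ℝ n (g t) x‖ₑ)] with t h x
  have h1 : ‖iteratedFDeriv ℝ n (g t) x‖ₑ ≤ componentENorm t0 tf k g := by
    refine ((le_iSup (fun x => ‖iteratedFDeriv ℝ n (g t) x‖ₑ) x).trans h).trans ?_
    exact Finset.single_le_sum (f := fun n => derivEssSup t0 tf n (g : ℝ → Vec nx → Vec ng))
      (fun _ _ => zero_le) (Finset.mem_range.2 (Nat.lt_succ_of_le hn))
  have h2 := ENNReal.toReal_mono g.2.finite.ne h1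
  rwa [toReal_enorm] at h2

/-- The point where order two is needed: the bound on the second derivative makes the first one
Lipschitz. -/
theorem ComponentSpace.ae_hasC2Bound (g : ComponentSpace t0 tf nx ng 2) :
    ∀ᵐ t ∂intervalMeasure t0 tf, HasC2Bound (g t) ‖g‖ := by
  filter_upwards [g.2.contDiff, g.derivEssSup_le_norm (n := 0) (by norm_num),
    g.derivEssSup_le_norm (n := 1) (by norm_num), g.derivEssSup_le_norm (n := 2) le_rfl]
    with t hc h0 h1 h2
  have hc' : ContDiff ℝ 2 (g t) := hc
  have hd : Differentiable ℝ (fderiv ℝ (g t)) :=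
    (hc'.fderiv_right (m := 1) (by norm_num)).differentiable (by norm_num)
  refine ⟨hc'.differentiable (by norm_num), fun x => ?_, fun x => ?_, fun x y => ?_⟩
  · simpa using h0 x
  · simpa [norm_iteratedFDeriv_one] using h1 x
  · refine convex_univ.norm_image_sub_le_of_norm_fderiv_le (𝕜 := ℝ) (fun z _ => hd z)
      (fun z _ => ?_) (mem_univ y) (mem_univ x)
    rw [← norm_iteratedFDeriv_one, norm_iteratedFDeriv_fderiv]
    exact h2 z

theorem ComponentSpace.aestronglyMeasurable_comp (g : ComponentSpace t0 tf nx ng 2)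
    {x : ℝ → Vec nx} (hx : AEStronglyMeasurable x (intervalMeasure t0 tf)) :
    AEStronglyMeasurable (fun t => g t (x t)) (intervalMeasure t0 tf) :=
  aestronglyMeasurable_caratheodory_comp
    (g.ae_hasC2Bound.mono fun _ h => h.differentiable.continuous) g.2.measurable hx

end Components

/-! ### Local bounds and Taylor estimates for the dynamics and the running cost. -/

section Smooth

variable {t0 tf : ℝ} {nx ng : ℕ} {Y : Type*} [NormedAddCommGroup Y] [NormedSpace ℝ Y]

/-- First-order bounds and Taylor's formula for `h(t, ·, ·)` on the balls of radius `R`. -/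
structure HasLocalBounds (h : ℝ → Vec nx → Vec ng → Y) (R C t : ℝ) : Prop where
  differentiable : Differentiable ℝ fun p : Vec nx × Vec ng => h t p.1 p.2
  bound : ∀ x g, ‖x‖ ≤ R → ‖g‖ ≤ R → ‖h t x g‖ ≤ C
  bound_partialX : ∀ x g, ‖x‖ ≤ R → ‖g‖ ≤ R → ‖partialX h t x g‖ ≤ C
  bound_partialG : ∀ x g, ‖x‖ ≤ R → ‖g‖ ≤ R → ‖partialG h t x g‖ ≤ C
  lipschitz : ∀ x y g k, ‖x‖ ≤ R → ‖y‖ ≤ R → ‖g‖ ≤ R → ‖k‖ ≤ R →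
    ‖h t y k - h t x g‖ ≤ C * (‖y - x‖ + ‖k - g‖)
  taylor : ∀ x y g k, ‖x‖ ≤ R → ‖y‖ ≤ R → ‖g‖ ≤ R → ‖k‖ ≤ R →
    ‖h t y k - h t x g - partialX h t x g (y - x) - partialG h t x g (k - g)‖
      ≤ C * (‖y - x‖ + ‖k - g‖) ^ 2

theorem fderiv_eq_partialX_add_partialG {h : ℝ → Vec nx → Vec ng → Y} {t : ℝ}
    (hd : Differentiable ℝ fun p : Vec nx × Vec ng => h t p.1 p.2) (x : Vec nx) (g : Vec ng) :
    fderiv ℝ (fun p : Vec nx × Vec ng => h t p.1 p.2) (x, g) =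
      (partialX h t x g).coprod (partialG h t x g) := by
  have h1 : partialX h t x g = (fderiv ℝ (fun p : Vec nx × Vec ng => h t p.1 p.2) (x, g)).comp
      (ContinuousLinearMap.inl ℝ (Vec nx) (Vec ng)) :=
    ((hd (x, g)).hasFDerivAt.comp (f := fun y => (y, g)) x (hasFDerivAt_prodMk_left x g)).fderiv
  have h2 : partialG h t x g = (fderiv ℝ (fun p : Vec nx × Vec ng => h t p.1 p.2) (x, g)).comp
      (ContinuousLinearMap.inr ℝ (Vec nx) (Vec ng)) :=
    ((hd (x, g)).hasFDerivAt.comp (f := fun y => (x, y)) g (hasFDerivAt_prodMk_right x g)).fderiv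
  rw [h1, h2, ← ContinuousLinearMap.comp_coprod]
  simp

/-- Growth is assumed only at x = 0, and the Lipschitz condition carries it from (0, g) to (x, g).
The Taylor estimate is the mean value inequality on a segment, with the Lipschitz bound on the
partial derivatives. -/
theorem IsSmoothCaratheodory.exists_hasLocalBounds {h : ℝ → Vec nx → Vec ng → Y}
    (hh : IsSmoothCaratheodory t0 tf h) {R : ℝ} (hR : 0 < R) :
    ∃ C, 0 < C ∧ ∀ᵐ t ∂intervalMeasure t0 tf, HasLocalBounds h R C t := by
  obtain ⟨K, hK, hgr⟩ := hh.growth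
  obtain ⟨K', hK', hgr'⟩ := hh.deriv_growth
  obtain ⟨L, hL⟩ := hh.lipschitz R hR
  obtain ⟨L', hL'⟩ := hh.deriv_lipschitz R hR
  -- One constant for all six bounds. Absolute values appear because nothing is assumed about the
  -- signs of `L` and `L'`.
  set C : ℝ := K * (R + 1) + K' * (R + 1) + (|L| + |L'|) * (R + 1) with hC
  have hC0 : 0 < C := by positivity
  have hLC : L ≤ C := by
    have := le_abs_self L
    have : 0 ≤ |L| * R := by positivity
    have : 0 ≤ |L'| * (R + 1) := by positivity
    have : 0 ≤ K * (R + 1) + K' * (R + 1) := by positivity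
    rw [hC]; linarith
  have hLC' : L' ≤ C := by
    have := le_abs_self L'
    have : 0 ≤ |L'| * R := by positivity
    have : 0 ≤ |L| * (R + 1) := by positivity
    have : 0 ≤ K * (R + 1) + K' * (R + 1) := by positivity
    rw [hC]; linarith
  -- Here `A` is the size at x = 0 and `B` the increment from 0 to `x`, for the function or for
  -- either partial derivative.
  have hsum : ∀ A B r s : ℝ, A ≤ K * (s + 1) ∨ A ≤ K' * (s + 1) → (B ≤ L * r ∨ B ≤ L' * r) →
      0 ≤ r → r ≤ R → s ≤ R → A + B ≤ C := by
    intro A B r s hA hB h0 hr hs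
    have h1 : A ≤ K * (R + 1) + K' * (R + 1) := by
      have a1 : K * (s + 1) ≤ K * (R + 1) := by gcongr
      have a2 : K' * (s + 1) ≤ K' * (R + 1) := by gcongr
      have a3 : 0 ≤ K * (R + 1) := by positivity
      have a4 : 0 ≤ K' * (R + 1) := by positivity
      rcases hA with hA | hA <;> linarith
    have h2 : B ≤ (|L| + |L'|) * (R + 1) := by
      have : B ≤ (|L| + |L'|) * r := by
        rcases hB with hB | hB
        · refine hB.trans ?_
          gcongr
          linarith [le_abs_self L, abs_nonneg L']
        · refine hB.trans ?_
          gcongr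
          linarith [le_abs_self L', abs_nonneg L]
      refine this.trans ?_
      gcongr
      linarith
    linarith
  refine ⟨C, hC0, ?_⟩
  filter_upwards [hgr, hgr', hL, hL', hh.contDiff] with t h1 h2 h3 h4 h5
  simp only [mem_closedBall_zero_iff] at h3 h4
  have hd : Differentiable ℝ fun p : Vec nx × Vec ng => h t p.1 p.2 :=
    h5.differentiable (by norm_num)
  have h00 : ‖(0 : Vec nx)‖ ≤ R := by simpa using hR.le
  refine ⟨hd, fun x g hx hg => ?_, fun x g hx hg => ?_, fun x g hx hg => ?_,
    fun x y g k hx hy hg hk => ?_, fun x y g k hx hy hg hk => ?_⟩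
  · have h6 := h3 x hx 0 h00 g hg g hg
    simp only [sub_self, norm_zero, add_zero, sub_zero] at h6
    exact (norm_le_insert' _ (h t 0 g)).trans
      (hsum _ _ ‖x‖ ‖g‖ (Or.inl (h1 g)) (Or.inl h6) (norm_nonneg _) hx hg)
  · have h6 := h4 x hx 0 h00 g hg g hg
    simp only [sub_self, norm_zero, add_zero, sub_zero] at h6
    exact (norm_le_insert' _ (partialX h t 0 g)).trans
      (hsum _ _ ‖x‖ ‖g‖ (Or.inr (h2 g).1)
        (Or.inr ((le_add_of_nonneg_right (norm_nonneg _)).trans h6)) (norm_nonneg _) hx hg)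
  · have h6 := h4 x hx 0 h00 g hg g hg
    simp only [sub_self, norm_zero, add_zero, sub_zero] at h6
    exact (norm_le_insert' _ (partialG h t 0 g)).trans
      (hsum _ _ ‖x‖ ‖g‖ (Or.inr (h2 g).2)
        (Or.inr ((le_add_of_nonneg_left (norm_nonneg _)).trans h6)) (norm_nonneg _) hx hg)
  · exact (h3 y hy x hx k hk g hg).trans (by gcongr)
  · have hcv : Convex ℝ (segment ℝ (x, g) (y, k)) := convex_segment _ _
    have hT := hcv.norm_image_sub_le_of_norm_fderiv_le' (𝕜 := ℝ)
      (f := fun p : Vec nx × Vec ng => h t p.1 p.2)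
      (φ := fderiv ℝ (fun p : Vec nx × Vec ng => h t p.1 p.2) (x, g))
      (C := C * (‖y - x‖ + ‖k - g‖)) (fun z _ => hd z) ?_
      (left_mem_segment ℝ _ _) (right_mem_segment ℝ _ _)
    · rw [fderiv_eq_partialX_add_partialG hd] at hT
      simp only [Prod.mk_sub_mk, ContinuousLinearMap.coprod_apply] at hT
      rw [sub_sub]
      refine hT.trans ?_
      rw [pow_two, ← mul_assoc]
      gcongr
      rw [Prod.norm_def]
      exact max_le_add_of_nonneg (norm_nonneg _) (norm_nonneg _)
    · rintro ⟨p, q⟩ hz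
      obtain ⟨hzp, hzq⟩ : p ∈ segment ℝ x y ∧ q ∈ segment ℝ g k := by
        obtain ⟨a, b, ha, hb, hab, e⟩ := hz
        exact ⟨⟨a, b, ha, hb, hab, congrArg Prod.fst e⟩, ⟨a, b, ha, hb, hab, congrArg Prod.snd e⟩⟩
      have hpR : ‖p‖ ≤ R := by
        simpa using (convex_closedBall (0 : Vec nx) R).segment_subset
          (by simpa using hx) (by simpa using hy) hzp
      have hqR : ‖q‖ ≤ R := by
        simpa using (convex_closedBall (0 : Vec ng) R).segment_subset
          (by simpa using hg) (by simpa using hk) hzq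
      rw [fderiv_eq_partialX_add_partialG hd, fderiv_eq_partialX_add_partialG hd]
      have h6 := h4 p hpR x hx q hqR g hg
      have e : (partialX h t p q).coprod (partialG h t p q) -
          (partialX h t x g).coprod (partialG h t x g) =
          (partialX h t p q - partialX h t x g).coprod (partialG h t p q - partialG h t x g) := by
        ext v <;> simp
      rw [e]
      have h7 : ‖(partialX h t p q - partialX h t x g).coprod
          (partialG h t p q - partialG h t x g)‖ ≤
          ‖partialX h t p q - partialX h t x g‖ + ‖partialG h t p q - partialG h t x g‖ := by
        refine ContinuousLinearMap.opNorm_le_bound _ (by positivity) fun v => ?_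
        rw [ContinuousLinearMap.coprod_apply, add_mul]
        refine (norm_add_le _ _).trans (add_le_add ?_ ?_)
        · exact (ContinuousLinearMap.le_opNorm _ _).trans (by gcongr; exact norm_fst_le v)
        · exact (ContinuousLinearMap.le_opNorm _ _).trans (by gcongr; exact norm_snd_le v)
      refine (h7.trans h6).trans ?_
      gcongr
      · simpa [norm_sub_rev] using norm_sub_le_of_mem_segment hzp
      · simpa [norm_sub_rev] using norm_sub_le_of_mem_segment hzq

variable {h : ℝ → Vec nx → Vec ng → Y} {R C t M d : ℝ} {x y : Vec nx} {u v w : Vec nx → Vec ng}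

/-- Lipschitz bound for the closed-loop function `x ↦ h(t, x, g(t, x))`, jointly in `x` and `g`. -/
theorem HasLocalBounds.norm_comp_sub_le (hh : HasLocalBounds h R C t) (hC : 0 ≤ C)
    (hv : HasC2Bound v M) (huR : ∀ z, ‖u z‖ ≤ R) (hvR : ∀ z, ‖v z‖ ≤ R)
    (hd : ∀ z, ‖u z - v z‖ ≤ d) (hx : ‖x‖ ≤ R) (hy : ‖y‖ ≤ R) :
    ‖h t y (u y) - h t x (v x)‖ ≤ C * d + C * (1 + M) * ‖y - x‖ := by
  have h1 := hv.lipschitz y x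
  have h2 : ‖u y - v x‖ ≤ d + M * ‖y - x‖ := by
    rw [← sub_add_sub_cancel (u y) (v y) (v x)]
    exact (norm_add_le _ _).trans (add_le_add (hd y) h1)
  refine (hh.lipschitz x y (v x) (u y) hx hy (hvR x) (huR y)).trans ?_
  calc C * (‖y - x‖ + ‖u y - v x‖) ≤ C * (‖y - x‖ + (d + M * ‖y - x‖)) := by gcongr
    _ = _ := by ring

/-- Taylor's formula for `h(t, x, g(t, x))`, jointly in `x` and `g`. -/
theorem HasLocalBounds.norm_comp_taylor_le (hh : HasLocalBounds h R C t) (hC : 0 ≤ C) (hM : 0 ≤ M)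
    (hd : 0 ≤ d) (hv : HasC2Bound v M) (hw : HasC2Bound w d) (huvw : ∀ z, u z - v z = w z)
    (huR : ∀ z, ‖u z‖ ≤ R) (hvR : ∀ z, ‖v z‖ ≤ R) (hx : ‖x‖ ≤ R) (hy : ‖y‖ ≤ R) :
    ‖h t y (u y) - h t x (v x) - (partialX h t x (v x) (y - x)
        + partialG h t x (v x) (fderiv ℝ v x (y - x))) - partialG h t x (v x) (w x)‖
      ≤ C * (M + 2) ^ 2 * (‖y - x‖ + d) ^ 2 := by
  have h0 : u y - v x = w y + (v y - v x) := by rw [← huvw y]; abel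
  have h2 : ‖u y - v x‖ ≤ d + M * ‖y - x‖ := by
    rw [h0]
    exact (norm_add_le _ _).trans (add_le_add (hw.bound y) (hv.lipschitz y x))
  have h3 := hh.taylor x y (v x) (u y) hx hy (hvR x) (huR y)
  -- Everything of second order in u(y) − v(x): the Taylor remainder of `v`, and w(y) − w(x), which
  -- is at most d‖y − x‖ because the same `d` bounds the derivative of `w`.
  set r : Vec ng := (v y - v x - fderiv ℝ v x (y - x)) + (w y - w x) with hr
  have h4 : ‖r‖ ≤ M * ‖y - x‖ ^ 2 + d * ‖y - x‖ :=
    (norm_add_le _ _).trans (add_le_add (hv.taylor hM y x) (hw.lipschitz y x))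
  have e1 : u y - v x = r + fderiv ℝ v x (y - x) + w x := by rw [h0, hr]; abel
  have e2 : h t y (u y) - h t x (v x) - (partialX h t x (v x) (y - x)
        + partialG h t x (v x) (fderiv ℝ v x (y - x))) - partialG h t x (v x) (w x)
      = (h t y (u y) - h t x (v x) - partialX h t x (v x) (y - x)
        - partialG h t x (v x) (u y - v x)) + partialG h t x (v x) r := by
    rw [e1, map_add, map_add]; abel
  have h5 : ‖partialG h t x (v x) r‖ ≤ C * ‖r‖ :=
    (ContinuousLinearMap.le_opNorm _ _).trans
      (by gcongr; exact hh.bound_partialG x (v x) hx (hvR x))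
  rw [e2]
  have hs := norm_nonneg (y - x)
  set s := ‖y - x‖
  calc _ ≤ C * (s + ‖u y - v x‖) ^ 2 + C * ‖r‖ := (norm_add_le _ _).trans (add_le_add h3 h5)
    _ ≤ C * (s + (d + M * s)) ^ 2 + C * (M * s ^ 2 + d * s) := by gcongr
    _ = C * ((s + (d + M * s)) ^ 2 + (M * s ^ 2 + d * s)) := by ring
    -- A crude constant: the difference of the two sides is a polynomial with nonnegative
    -- coefficients.
    _ ≤ C * ((M + 2) ^ 2 * (s + d) ^ 2) := by
      gcongr
      have e3 : (M + 2) ^ 2 * (s + d) ^ 2 - ((s + (d + M * s)) ^ 2 + (M * s ^ 2 + d * s)) =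
          s ^ 2 * (M + 3) + s * d * (2 * M ^ 2 + 6 * M + 5) + d ^ 2 * (M ^ 2 + 4 * M + 3) := by
        ring
      have e4 : 0 ≤ s ^ 2 * (M + 3) + s * d * (2 * M ^ 2 + 6 * M + 5)
          + d ^ 2 * (M ^ 2 + 4 * M + 3) := by positivity
      linarith
    _ = _ := by ring

end Smooth

/-! ### Measurability of derivatives along trajectories. -/

section Measurability

variable {t0 tf : ℝ} {nx ng : ℕ} {Y : Type*} [NormedAddCommGroup Y] [NormedSpace ℝ Y]
  {h : ℝ → Vec nx → Vec ng → Y} {x v : ℝ → Vec nx} {g w : ℝ → Vec ng}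

theorem IsSmoothCaratheodory.aestronglyMeasurable_comp (hh : IsSmoothCaratheodory t0 tf h)
    (hx : AEStronglyMeasurable x (intervalMeasure t0 tf))
    (hg : AEStronglyMeasurable g (intervalMeasure t0 tf)) :
    AEStronglyMeasurable (fun t => h t (x t) (g t)) (intervalMeasure t0 tf) :=
  aestronglyMeasurable_caratheodory_comp (u := fun t (p : Vec nx × Vec ng) => h t p.1 p.2)
    hh.continuous (fun p => hh.measurable p.1 p.2) (hx.prodMk hg)

/-- Derivatives along a trajectory are limits of difference quotients of measurable superpositions.
Applying them to a direction keeps the argument free of operator-valued measurability. The step 1/(n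
+ 1) avoids division by zero at n = 0. -/
theorem tendsto_difference_quotient {E : Type*} [NormedAddCommGroup E] [NormedSpace ℝ E]
    {u : E → Y} {p : E} (hu : DifferentiableAt ℝ u p) (q : E) :
    Tendsto (fun n : ℕ => ((n : ℝ) + 1) • (u (p + ((n : ℝ) + 1)⁻¹ • q) - u p)) atTop
      (𝓝 (fderiv ℝ u p q)) := by
  refine (hasFDerivWithinAt_univ.2 hu.hasFDerivAt).lim (c := fun n : ℕ => (n : ℝ) + 1)
    (d := fun n : ℕ => ((n : ℝ) + 1)⁻¹ • q) ?_ (Eventually.of_forall fun _ => mem_univ _) ?_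
  · have h1 : Tendsto (fun n : ℕ => ((n : ℝ) + 1)⁻¹) atTop (𝓝 0) := by
      simpa using tendsto_one_div_add_atTop_nhds_zero_nat (𝕜 := ℝ)
    simpa using h1.smul_const q
  · refine tendsto_const_nhds.congr fun n => ?_
    have : (n : ℝ) + 1 ≠ 0 := by positivity
    rw [smul_smul, mul_inv_cancel₀ this, one_smul]

theorem IsSmoothCaratheodory.aestronglyMeasurable_partialX (hh : IsSmoothCaratheodory t0 tf h)
    (hx : AEStronglyMeasurable x (intervalMeasure t0 tf))
    (hg : AEStronglyMeasurable g (intervalMeasure t0 tf))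
    (hv : AEStronglyMeasurable v (intervalMeasure t0 tf)) :
    AEStronglyMeasurable (fun t => partialX h t (x t) (g t) (v t)) (intervalMeasure t0 tf) := by
  refine aestronglyMeasurable_of_tendsto_ae (atTop : Filter ℕ)
    (f := fun n t => ((n : ℝ) + 1) • (h t (x t + ((n : ℝ) + 1)⁻¹ • v t) (g t) - h t (x t) (g t)))
    (fun n => ?_) ?_
  · exact ((hh.aestronglyMeasurable_comp (hx.add (hv.const_smul (((n : ℝ) + 1)⁻¹))) hg).sub
      (hh.aestronglyMeasurable_comp hx hg)).const_smul _
  · filter_upwards [hh.contDiff] with t ht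
    have hd : Differentiable ℝ fun p : Vec nx × Vec ng => h t p.1 p.2 :=
      ht.differentiable (by norm_num)
    have hd' : DifferentiableAt ℝ (fun y => h t y (g t)) (x t) :=
      (hd (x t, g t)).comp (f := fun y => (y, g t)) (x t) (by fun_prop)
    exact tendsto_difference_quotient hd' (v t)

theorem IsSmoothCaratheodory.aestronglyMeasurable_partialG (hh : IsSmoothCaratheodory t0 tf h)
    (hx : AEStronglyMeasurable x (intervalMeasure t0 tf))
    (hg : AEStronglyMeasurable g (intervalMeasure t0 tf))
    (hw : AEStronglyMeasurable w (intervalMeasure t0 tf)) :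
    AEStronglyMeasurable (fun t => partialG h t (x t) (g t) (w t)) (intervalMeasure t0 tf) := by
  refine aestronglyMeasurable_of_tendsto_ae (atTop : Filter ℕ)
    (f := fun n t => ((n : ℝ) + 1) • (h t (x t) (g t + ((n : ℝ) + 1)⁻¹ • w t) - h t (x t) (g t)))
    (fun n => ?_) ?_
  · exact ((hh.aestronglyMeasurable_comp hx (hg.add (hw.const_smul (((n : ℝ) + 1)⁻¹)))).sub
      (hh.aestronglyMeasurable_comp hx hg)).const_smul _
  · filter_upwards [hh.contDiff] with t ht
    have hd : Differentiable ℝ fun p : Vec nx × Vec ng => h t p.1 p.2 :=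
      ht.differentiable (by norm_num)
    have hd' : DifferentiableAt ℝ (fun k => h t (x t) k) (g t) :=
      (hd (x t, g t)).comp (f := fun k => (x t, k)) (g t) (by fun_prop)
    exact tendsto_difference_quotient hd' (w t)

theorem ComponentSpace.aestronglyMeasurable_jacobianAlong (g : ComponentSpace t0 tf nx ng 2)
    (hx : AEStronglyMeasurable x (intervalMeasure t0 tf))
    (hv : AEStronglyMeasurable v (intervalMeasure t0 tf)) :
    AEStronglyMeasurable (fun t => jacobianAlong g x t (v t)) (intervalMeasure t0 tf) := by
  refine aestronglyMeasurable_of_tendsto_ae (atTop : Filter ℕ)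
    (f := fun n t => ((n : ℝ) + 1) • (g t (x t + ((n : ℝ) + 1)⁻¹ • v t) - g t (x t)))
    (fun n => ?_) ?_
  · exact ((g.aestronglyMeasurable_comp (hx.add (hv.const_smul (((n : ℝ) + 1)⁻¹)))).sub
      (g.aestronglyMeasurable_comp hx)).const_smul ((n : ℝ) + 1)
  · filter_upwards [g.ae_hasC2Bound] with t ht
    exact tendsto_difference_quotient (ht.differentiable (x t)) (v t)

end Measurability

/-! ### Uniqueness, existence and stability of states. -/

section States

variable {t0 tf : ℝ} {nx ng : ℕ} {f : ℝ → Vec nx → Vec ng → Vec nx} {x0 : Vec nx}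

theorem isState_stateOf {g : ℝ → Vec nx → Vec ng} (h : ∃ x, IsState t0 tf f x0 g x) :
    IsState t0 tf f x0 g (stateOf t0 tf f x0 g) := by
  rw [stateOf, dif_pos h]
  exact h.choose_spec

theorem ComponentSpace.norm_apply_le_of_norm_sub_le_one {gbar g : ComponentSpace t0 tf nx ng 2}
    (hg : ‖g - gbar‖ ≤ 1) {R : ℝ} (hR : ‖gbar‖ + 1 ≤ R) {t : ℝ} (h : HasC2Bound (g t) ‖g‖)
    (z : Vec nx) : ‖g t z‖ ≤ R := by
  have h1 : ‖g‖ ≤ ‖gbar‖ + ‖g - gbar‖ := norm_le_insert' _ _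
  exact (h.bound z).trans (by linarith)

theorem norm_sub_le_of_hasDerivAt (ht : t0 ≤ tf) {x y a b : ℝ → Vec nx} {p q : ℝ} (hp : 0 ≤ p)
    (hq : 0 < q) (hx : AbsolutelyContinuousOnInterval x t0 tf)
    (hy : AbsolutelyContinuousOnInterval y t0 tf) (h0 : x t0 = y t0)
    (hxd : ∀ᵐ t ∂intervalMeasure t0 tf, HasDerivAt x (a t) t)
    (hyd : ∀ᵐ t ∂intervalMeasure t0 tf, HasDerivAt y (b t) t)
    (hab : ∀ᵐ t ∂intervalMeasure t0 tf, ‖a t - b t‖ ≤ p + q * ‖x t - y t‖) :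
    ∀ t ∈ Icc t0 tf, ‖x t - y t‖ ≤ p * ((tf - t0) * Real.exp (q * (tf - t0))) := by
  refine norm_le_of_norm_hasDerivAt_le (x := x - y) (h := fun t => a t - b t) ht hp hq
    (hx.sub hy) (by simp [h0]) ?_ hab
  filter_upwards [hxd, hyd] with t h1 h2
  exact h1.sub h2

/-- Grönwall with zero forcing, on a ball large enough to contain both trajectories and all values
of `g`, where the closed-loop field is Lipschitz. -/
theorem IsState.eqOn (ht : t0 ≤ tf) (hf : IsSmoothCaratheodory t0 tf f)
    {g : ComponentSpace t0 tf nx ng 2} {x y : ℝ → Vec nx} (hx : IsState t0 tf f x0 g x)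
    (hy : IsState t0 tf f x0 g y) : EqOn x y (Icc t0 tf) := by
  obtain ⟨ρ, hρ0, hρ⟩ := exists_norm_le_of_absolutelyContinuous ht hx.memW1Inf.1
  obtain ⟨σ, hσ0, hσ⟩ := exists_norm_le_of_absolutelyContinuous ht hy.memW1Inf.1
  have hg0 := norm_nonneg g
  obtain ⟨C, hC, hb⟩ := hf.exists_hasLocalBounds (R := ρ + σ + ‖g‖ + 1) (by positivity)
  have h := norm_sub_le_of_hasDerivAt (p := 0) (q := C * (1 + ‖g‖)) ht le_rfl (by positivity)
    hx.memW1Inf.1 hy.memW1Inf.1 (hx.initial.trans hy.initial.symm) hx.ode hy.ode ?_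
  · intro t htm
    have := h t htm
    rw [zero_mul] at this
    exact sub_eq_zero.1 (norm_le_zero_iff.1 this)
  · filter_upwards [hb, g.ae_hasC2Bound, ae_intervalMeasure_mem] with t h1 h2 h3
    have h3' := Ioo_subset_Icc_self h3
    have h4 := h1.norm_comp_sub_le hC.le h2 (fun z => (h2.bound z).trans (by linarith))
      (fun z => (h2.bound z).trans (by linarith)) (d := 0) (fun z => by simp)
      ((hσ t h3').trans (by linarith)) ((hρ t h3').trans (by linarith))
    simpa using h4

theorem IsState.intervalIntegrable (ht : t0 ≤ tf) {l : ℝ → Vec nx → Vec ng → ℝ}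
    (hl : IsSmoothCaratheodory t0 tf l) {g : ComponentSpace t0 tf nx ng 2} {x : ℝ → Vec nx}
    (hx : IsState t0 tf f x0 g x) :
    IntervalIntegrable (fun t => l t (x t) (g t (x t))) volume t0 tf := by
  obtain ⟨ρ, hρ0, hρ⟩ := exists_norm_le_of_absolutelyContinuous ht hx.memW1Inf.1
  have hxm := aestronglyMeasurable_of_absolutelyContinuous ht hx.memW1Inf.1
  have hg0 := norm_nonneg g
  obtain ⟨C, hC, hb⟩ := hl.exists_hasLocalBounds (R := ρ + ‖g‖ + 1) (by positivity)
  refine intervalIntegrable_of_ae_bounded (C := C) ht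
    (hl.aestronglyMeasurable_comp hxm (g.aestronglyMeasurable_comp hxm)) ?_
  filter_upwards [hb, g.ae_hasC2Bound, ae_intervalMeasure_mem] with t h1 h2 h3
  exact h1.bound _ _ ((hρ t (Ioo_subset_Icc_self h3)).trans (by linarith))
    ((h2.bound _).trans (by linarith))

/-- Existence and Lipschitz dependence of the state on the component function. -/
theorem IsState.exists_nearby (ht : t0 ≤ tf) (hf : IsSmoothCaratheodory t0 tf f)
    {gbar : ComponentSpace t0 tf nx ng 2} {xbar : ℝ → Vec nx}
    (hx : IsState t0 tf f x0 gbar xbar) :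
    ∃ ε > 0, ∃ C, 0 ≤ C ∧ C * ε ≤ 1 ∧ ε ≤ 1 ∧ ∀ g : ComponentSpace t0 tf nx ng 2,
      ‖g - gbar‖ ≤ ε → ∃ x, IsState t0 tf f x0 g x ∧
        ∀ t ∈ Icc t0 tf, ‖x t - xbar t‖ ≤ C * ‖g - gbar‖ := by
  obtain ⟨ρ, hρ0, hρ⟩ := exists_norm_le_of_absolutelyContinuous ht hx.memW1Inf.1
  have hg0 := norm_nonneg gbar
  -- The extra 1 leaves room for states within distance 1 of `xbar` and for `g` within distance 1 of
  -- `gbar`.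
  set R : ℝ := ρ + ‖gbar‖ + 1 with hR
  have hR0 : 0 < R := by positivity
  obtain ⟨C, hC, hb⟩ := hf.exists_hasLocalBounds hR0
  obtain ⟨P, hPlip, hPR, hPid⟩ := exists_ball_retraction (E := Vec nx) hR0.le
  have htt : 0 ≤ tf - t0 := sub_nonneg.2 ht
  set C₁ : ℝ := C * ((tf - t0) * Real.exp (C * (1 + ‖gbar‖) * (tf - t0))) with hC₁
  have hC₁0 : 0 ≤ C₁ := by positivity
  -- This radius is at most 1 and satisfies C₁ε ≤ 1, so the perturbed values and the perturbed state
  -- both stay in the ball of radius `R`.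
  refine ⟨1 / (C₁ + 1), by positivity, C₁, hC₁0, ?_, ?_, fun g hg => ?_⟩
  · rw [mul_one_div, div_le_one (by positivity)]; linarith
  · rw [div_le_one (by positivity)]; linarith
  have hg1 : ‖g - gbar‖ ≤ 1 := hg.trans (by rw [div_le_one (by positivity)]; linarith)
  have hCg : C₁ * ‖g - gbar‖ ≤ 1 := by
    calc C₁ * ‖g - gbar‖ ≤ C₁ * (1 / (C₁ + 1)) := by gcongr
      _ ≤ 1 := by rw [mul_one_div, div_le_one (by positivity)]; linarith
  have hgR : ‖gbar‖ + 1 ≤ R := by linarith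
  have hLg : 0 ≤ C * (1 + ‖g‖) := mul_nonneg hC.le (add_nonneg zero_le_one (norm_nonneg g))
  have hLb : 0 < C * (1 + ‖gbar‖) := mul_pos hC (add_pos_of_pos_of_nonneg one_pos hg0)
  have hd0 : 0 ≤ C * ‖g - gbar‖ := mul_nonneg hC.le (norm_nonneg _)
  -- The field truncated by `P` is globally Lipschitz and bounded at 0, so a solution exists on the
  -- whole interval.
  obtain ⟨x, K, hxK, hx0, hxd⟩ := exists_caratheodory_solution (M := C)
    (L := C * (1 + ‖g‖)) (F := fun t x => f t (P x) (g t (P x))) ht hLg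
    (fun x => hf.aestronglyMeasurable_comp aestronglyMeasurable_const
      (g.aestronglyMeasurable_comp aestronglyMeasurable_const)) (by
      filter_upwards [hb, g.ae_hasC2Bound] with t h1 h2 x y
      have h3 := ComponentSpace.norm_apply_le_of_norm_sub_le_one hg1 hgR h2
      have h4 := h1.norm_comp_sub_le hC.le h2 h3 h3 (d := 0) (fun z => by simp) (hPR y) (hPR x)
      rw [mul_zero, zero_add] at h4
      exact h4.trans (mul_le_mul_of_nonneg_left (hPlip x y) hLg)) (by
      filter_upwards [hb, g.ae_hasC2Bound] with t h1 h2
      exact h1.bound _ _ (hPR 0)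
        (ComponentSpace.norm_apply_le_of_norm_sub_le_one hg1 hgR h2 _)) x0
  have hxW := memW1Inf_of_lipschitzOnWith ht hxK
  -- The Lipschitz constant used is that of `gbar`, with `g − gbar` treated as forcing; hence `C₁`
  -- does not depend on `g`. Since `P` fixes `xbar`, the truncation costs nothing here.
  have hest := norm_sub_le_of_hasDerivAt (p := C * ‖g - gbar‖) (q := C * (1 + ‖gbar‖)) ht
    hd0 hLb hxW.1 hx.memW1Inf.1 (hx0.trans hx.initial.symm) hxd hx.ode (by
      filter_upwards [hb, g.ae_hasC2Bound, gbar.ae_hasC2Bound, (g - gbar).ae_hasC2Bound,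
        ae_intervalMeasure_mem] with t h1 h2 h3 h4 h5
      have h6 : ‖xbar t‖ ≤ R := (hρ t (Ioo_subset_Icc_self h5)).trans (by linarith)
      have h7 := h1.norm_comp_sub_le hC.le h3
        (ComponentSpace.norm_apply_le_of_norm_sub_le_one hg1 hgR h2)
        (fun z => (h3.bound z).trans (by linarith)) (fun z => h4.bound z) h6 (hPR (x t))
      have h8 := hPlip (x t) (xbar t)
      rw [hPid _ h6] at h8
      exact h7.trans (add_le_add_right (mul_le_mul_of_nonneg_left h8 hLb.le) _))
  have hest' : ∀ t ∈ Icc t0 tf, ‖x t - xbar t‖ ≤ C₁ * ‖g - gbar‖ := fun t h =>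
    (hest t h).trans (by rw [hC₁]; linarith)
  refine ⟨x, ⟨hxW, hx0, ?_⟩, hest'⟩
  filter_upwards [hxd, ae_intervalMeasure_mem] with t h1 h2
  -- The trajectory never leaves the ball, so the truncation is inactive and `x` solves the original
  -- equation.
  have h3 : ‖x t‖ ≤ R := by
    have h4 := hest' t (Ioo_subset_Icc_self h2)
    have h5 := hρ t (Ioo_subset_Icc_self h2)
    have h6 : ‖x t‖ ≤ ‖xbar t‖ + ‖x t - xbar t‖ := norm_le_insert' _ _
    linarith
  rwa [hPid _ h3] at h1

end States

/-! ### Terminal value problems and tools for the duality pairing. -/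

section Backward

variable {t0 tf : ℝ}

/-- Reversing time turns a terminal value problem into an initial value problem; measure
preservation transports null sets and measurability. -/
theorem measurePreserving_reflection :
    MeasurePreserving (fun t : ℝ => t0 + tf - t) (intervalMeasure t0 tf)
      (intervalMeasure t0 tf) := by
  have h := (Measure.measurePreserving_sub_left (volume : Measure ℝ) (t0 + tf)).restrict_preimage
    (measurableSet_Ioo (a := t0) (b := tf))
  rw [preimage_const_sub_Ioo] at h
  simpa using h

/-- Global existence for the terminal value problem. -/
theorem exists_caratheodory_solution_backward {E : Type*} [NormedAddCommGroup E] [NormedSpace ℝ E]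
    [CompleteSpace E] (ht : t0 ≤ tf) {F : ℝ → E → E} {L M : ℝ} (hL : 0 ≤ L)
    (hm : ∀ x, AEStronglyMeasurable (fun t => F t x) (intervalMeasure t0 tf))
    (hlip : ∀ᵐ t ∂intervalMeasure t0 tf, ∀ x y, ‖F t x - F t y‖ ≤ L * ‖x - y‖)
    (hM : ∀ᵐ t ∂intervalMeasure t0 tf, ‖F t 0‖ ≤ M) (x1 : E) :
    ∃ (x : ℝ → E) (K : NNReal), LipschitzOnWith K x (Icc t0 tf) ∧ x tf = x1 ∧
      ∀ᵐ t ∂intervalMeasure t0 tf, HasDerivAt x (F t (x t)) t := by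
  have hσ := measurePreserving_reflection (t0 := t0) (tf := tf)
  obtain ⟨y, K, hyK, hy0, hyd⟩ := exists_caratheodory_solution ht
    (F := fun t x => -F (t0 + tf - t) x) hL
    (fun x => ((hm x).comp_measurePreserving hσ).neg) (by
      filter_upwards [hσ.quasiMeasurePreserving.ae hlip] with t h x y
      rw [← neg_sub', norm_neg]
      exact h x y) (by
      filter_upwards [hσ.quasiMeasurePreserving.ae hM] with t h
      rwa [norm_neg]) x1
  refine ⟨fun t => y (t0 + tf - t), K, ?_, by simpa using hy0, ?_⟩
  · refine LipschitzOnWith.of_dist_le_mul fun s hs t ht' => ?_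
    have h := hyK.dist_le_mul (t0 + tf - s) ⟨by linarith [hs.2], by linarith [hs.1]⟩
      (t0 + tf - t) ⟨by linarith [ht'.2], by linarith [ht'.1]⟩
    rwa [dist_sub_left] at h
  · filter_upwards [hσ.quasiMeasurePreserving.ae hyd] with t h
    have h1 := h.comp_const_sub
    simpa using h1

/-- `MemW1Inf` bounds `deriv x`, which defaults to 0 where `x` is not differentiable.
Almost-everywhere differentiability makes it the true derivative, so the fundamental theorem of
calculus applies. -/
theorem MemW1Inf.exists_lipschitzOnWith (ht : t0 ≤ tf) {n : ℕ} {x : ℝ → Vec n}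
    (h : MemW1Inf t0 tf x) (hd : ∀ᵐ t ∂intervalMeasure t0 tf, DifferentiableAt ℝ x t) :
    ∃ K, LipschitzOnWith K x (Icc t0 tf) := by
  obtain ⟨C, hC⟩ : ∃ C, ∀ᵐ t ∂intervalMeasure t0 tf, ‖deriv x t‖ ≤ C := by
    have h1 := h.2.2
    rw [eLpNorm_exponent_top] at h1
    refine ⟨(eLpNormEssSup (deriv x) (intervalMeasure t0 tf)).toReal, ?_⟩
    filter_upwards [ae_le_eLpNormEssSup (f := deriv x) (μ := intervalMeasure t0 tf)] with t h2
    have h3 := ENNReal.toReal_mono h1.ne h2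
    rwa [toReal_enorm] at h3
  have h1 := (eq_add_integral_of_absolutelyContinuous ht h.1
    (hd.mono fun t h => h.hasDerivAt) hC).2
  refine ⟨C.toNNReal, LipschitzOnWith.of_dist_le_mul fun s hs t htm => ?_⟩
  rw [h1 s hs, h1 t htm, dist_add_left]
  exact (lipschitzOnWith_primitive ht (aestronglyMeasurable_deriv x _) hC).dist_le_mul s hs t htm

/-- Bounded Lipschitz factors have a Lipschitz product. This justifies integrating the derivative of
⟨λ, x − x̄⟩. -/
theorem absolutelyContinuousOnInterval_inner (ht : t0 ≤ tf) {n : ℕ} {x y : ℝ → Vec n}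
    {K K' : NNReal} (hx : LipschitzOnWith K x (Icc t0 tf)) (hy : LipschitzOnWith K' y (Icc t0 tf)) :
    AbsolutelyContinuousOnInterval (fun t => inner ℝ (x t) (y t)) t0 tf := by
  have hx' := hx
  have hy' := hy
  rw [← uIcc_of_le ht] at hx' hy'
  obtain ⟨ρ, hρ0, hρ⟩ := exists_norm_le_of_absolutelyContinuous ht
    hx'.absolutelyContinuousOnInterval
  obtain ⟨σ, hσ0, hσ⟩ := exists_norm_le_of_absolutelyContinuous ht
    hy'.absolutelyContinuousOnInterval
  have h : LipschitzOnWith (K * ⟨σ, hσ0⟩ + ⟨ρ, hρ0⟩ * K') (fun t => inner ℝ (x t) (y t))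
      (Icc t0 tf) := by
    refine LipschitzOnWith.of_dist_le_mul fun s hs t htm => ?_
    have h1 := hx.dist_le_mul s hs t htm
    have h2 := hy.dist_le_mul s hs t htm
    rw [dist_eq_norm] at h1 h2
    have e : inner ℝ (x s) (y s) - inner ℝ (x t) (y t) =
        inner ℝ (x s - x t) (y s) + inner ℝ (x t) (y s - y t) := by
      rw [inner_sub_left, inner_sub_right]; ring
    rw [dist_eq_norm, e]
    push_cast
    calc _ ≤ ‖x s - x t‖ * ‖y s‖ + ‖x t‖ * ‖y s - y t‖ :=
          (norm_add_le _ _).trans (add_le_add (norm_inner_le_norm _ _) (norm_inner_le_norm _ _))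
      _ ≤ K * dist s t * σ + ρ * (K' * dist s t) := by
          gcongr
          · exact hσ s hs
          · exact hρ t htm
      _ = (K * σ + ρ * K') * dist s t := by ring
  rw [← uIcc_of_le ht] at h
  exact h.absolutelyContinuousOnInterval

/-- Expansion in an orthonormal basis. It serves the adjoint field, whose transposes become explicit
only after pairing with a vector. -/
theorem aestronglyMeasurable_of_inner {α : Type*} [MeasurableSpace α] {μ : Measure α} {n : ℕ}
    {w : α → Vec n} (h : ∀ v, AEStronglyMeasurable (fun t => inner ℝ (w t) v) μ) :
    AEStronglyMeasurable w μ := by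
  have e : w = fun t => ∑ i, (inner ℝ (w t) (EuclideanSpace.basisFun (Fin n) ℝ i)) •
      EuclideanSpace.basisFun (Fin n) ℝ i := by
    funext t
    conv_lhs => rw [← (EuclideanSpace.basisFun (Fin n) ℝ).sum_repr' (w t)]
    exact Finset.sum_congr rfl fun i _ => by rw [real_inner_comm]
  rw [e]
  exact Finset.aestronglyMeasurable_fun_sum _ fun i _ => (h _).smul_const _

end Backward

/-! ### The adjoint equation and the sensitivity integrand. -/

section Adjoint

variable {t0 tf : ℝ} {nx ng : ℕ} {f : ℝ → Vec nx → Vec ng → Vec nx}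
  {l : ℝ → Vec nx → Vec ng → ℝ} {φ : Vec nx → ℝ} {x0 : Vec nx}

theorem inner_gradient {E : Type*} [NormedAddCommGroup E] [InnerProductSpace ℝ E]
    [CompleteSpace E] (u : E → ℝ) (p v : E) : inner ℝ (gradient u p) v = fderiv ℝ u p v := by
  rw [gradient, InnerProductSpace.toDual_symm_apply]

theorem norm_gradient {E : Type*} [NormedAddCommGroup E] [InnerProductSpace ℝ E]
    [CompleteSpace E] (u : E → ℝ) (p : E) : ‖gradient u p‖ = ‖fderiv ℝ u p‖ := by
  rw [gradient, LinearIsometryEquiv.norm_map]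

theorem matA_apply (g : ℝ → Vec nx → Vec ng) (x : ℝ → Vec nx) (t : ℝ) (v : Vec nx) :
    matA f g x t v = partialX f t (x t) (g t (x t)) v +
      partialG f t (x t) (g t (x t)) (fderiv ℝ (g t) (x t) v) := rfl

/-- The right-hand side of the adjoint equation. -/
noncomputable def adjointField (f : ℝ → Vec nx → Vec ng → Vec nx) (l : ℝ → Vec nx → Vec ng → ℝ)
    (g : ℝ → Vec nx → Vec ng) (x : ℝ → Vec nx) (t : ℝ) (p : Vec nx) : Vec nx :=
  -(ContinuousLinearMap.adjoint (matA f g x t) p + gradXAlong l g x t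
    + ContinuousLinearMap.adjoint (jacobianAlong g x t) (gradGAlong l g x t))

/-- Pairing removes all transposes and gradients, leaving precisely the `x`-linearizations of the
closed-loop `f` and `l`, with a minus sign. -/
theorem inner_adjointField (g : ℝ → Vec nx → Vec ng) (x : ℝ → Vec nx) (t : ℝ) (p v : Vec nx) :
    inner ℝ (adjointField f l g x t p) v = -(inner ℝ p (matA f g x t v) +
      (partialX l t (x t) (g t (x t)) v +
        partialG l t (x t) (g t (x t)) (fderiv ℝ (g t) (x t) v))) := by
  rw [adjointField, inner_neg_left, inner_add_left, inner_add_left,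
    ContinuousLinearMap.adjoint_inner_left, ContinuousLinearMap.adjoint_inner_left, gradXAlong,
    gradGAlong, inner_gradient, inner_gradient, add_assoc]
  rfl

/-- The integrand representing the derivative of the quantity of interest. -/
noncomputable def sensitivityIntegrand (f : ℝ → Vec nx → Vec ng → Vec nx)
    (l : ℝ → Vec nx → Vec ng → ℝ) (g : ℝ → Vec nx → Vec ng) (x lam : ℝ → Vec nx)
    (w : ℝ → Vec nx → Vec ng) (t : ℝ) : ℝ :=
  inner ℝ (ContinuousLinearMap.adjoint (matB f g x t) (lam t) + gradGAlong l g x t) (w t (x t))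

theorem sensitivityIntegrand_eq (g : ℝ → Vec nx → Vec ng) (x lam : ℝ → Vec nx)
    (w : ℝ → Vec nx → Vec ng) (t : ℝ) : sensitivityIntegrand f l g x lam w t =
      inner ℝ (lam t) (partialG f t (x t) (g t (x t)) (w t (x t))) +
        partialG l t (x t) (g t (x t)) (w t (x t)) := by
  rw [sensitivityIntegrand, inner_add_left, ContinuousLinearMap.adjoint_inner_left, gradGAlong,
    inner_gradient]
  rfl

variable {gbar : ComponentSpace t0 tf nx ng 2} {xbar : ℝ → Vec nx}

theorem aestronglyMeasurable_adjointField (hf : IsSmoothCaratheodory t0 tf f)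
    (hl : IsSmoothCaratheodory t0 tf l)
    (hx : AEStronglyMeasurable xbar (intervalMeasure t0 tf)) (p : Vec nx) :
    AEStronglyMeasurable (fun t => adjointField f l gbar xbar t p) (intervalMeasure t0 tf) := by
  refine aestronglyMeasurable_of_inner fun v => ?_
  simp_rw [inner_adjointField, matA_apply]
  have hg := gbar.aestronglyMeasurable_comp hx
  have hv : AEStronglyMeasurable (fun _ : ℝ => v) (intervalMeasure t0 tf) :=
    aestronglyMeasurable_const
  have hj := gbar.aestronglyMeasurable_jacobianAlong hx hv
  exact ((aestronglyMeasurable_const.inner ((hf.aestronglyMeasurable_partialX hx hg hv).add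
    (hf.aestronglyMeasurable_partialG hx hg hj))).add
    ((hl.aestronglyMeasurable_partialX hx hg hv).add
      (hl.aestronglyMeasurable_partialG hx hg hj))).neg

/-- The field is affine in λ with coefficients bounded along x̄, hence globally Lipschitz; no
truncation is needed. -/
theorem exists_isAdjointState (ht : t0 ≤ tf) (hf : IsSmoothCaratheodory t0 tf f)
    (hl : IsSmoothCaratheodory t0 tf l) (hx : AbsolutelyContinuousOnInterval xbar t0 tf) :
    ∃ lam, IsAdjointState t0 tf f φ l gbar xbar lam := by
  obtain ⟨ρ, hρ0, hρ⟩ := exists_norm_le_of_absolutelyContinuous ht hx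
  have hg0 := norm_nonneg gbar
  have hR0 : 0 < ρ + ‖gbar‖ + 1 := by positivity
  obtain ⟨C, hC, hb⟩ := hf.exists_hasLocalBounds hR0
  obtain ⟨C', hC', hb'⟩ := hl.exists_hasLocalBounds hR0
  obtain ⟨lam, K, hK, hT, hode⟩ := exists_caratheodory_solution_backward ht
    (F := adjointField f l gbar xbar) (L := C + C * ‖gbar‖) (M := C' + ‖gbar‖ * C')
    (by positivity)
    (aestronglyMeasurable_adjointField hf hl (aestronglyMeasurable_of_absolutelyContinuous ht hx))
    (by
      filter_upwards [hb, gbar.ae_hasC2Bound, ae_intervalMeasure_mem] with t h1 h2 h3 p q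
      have hxR : ‖xbar t‖ ≤ ρ + ‖gbar‖ + 1 := (hρ t (Ioo_subset_Icc_self h3)).trans (by linarith)
      have hgR : ‖gbar t (xbar t)‖ ≤ ρ + ‖gbar‖ + 1 := (h2.bound _).trans (by linarith)
      have e : adjointField f l gbar xbar t p - adjointField f l gbar xbar t q =
          -(ContinuousLinearMap.adjoint (matA f gbar xbar t) (p - q)) := by
        rw [adjointField, adjointField, map_sub]; abel
      rw [e, norm_neg]
      refine (ContinuousLinearMap.le_opNorm _ _).trans ?_
      rw [LinearIsometryEquiv.norm_map]
      refine mul_le_mul_of_nonneg_right ?_ (norm_nonneg _)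
      refine (norm_add_le _ _).trans (add_le_add (h1.bound_partialX _ _ hxR hgR) ?_)
      exact (ContinuousLinearMap.opNorm_comp_le _ _).trans
        (mul_le_mul (h1.bound_partialG _ _ hxR hgR) (h2.bound_fderiv _) (norm_nonneg _) hC.le))
    (by
      filter_upwards [hb', gbar.ae_hasC2Bound, ae_intervalMeasure_mem] with t h1 h2 h3
      have hxR : ‖xbar t‖ ≤ ρ + ‖gbar‖ + 1 := (hρ t (Ioo_subset_Icc_self h3)).trans (by linarith)
      have hgR : ‖gbar t (xbar t)‖ ≤ ρ + ‖gbar‖ + 1 := (h2.bound _).trans (by linarith)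
      rw [adjointField, map_zero, zero_add, norm_neg]
      refine (norm_add_le _ _).trans (add_le_add ?_ ?_)
      · rw [gradXAlong, norm_gradient]
        exact h1.bound_partialX _ _ hxR hgR
      · refine (ContinuousLinearMap.le_opNorm _ _).trans ?_
        rw [LinearIsometryEquiv.norm_map, gradGAlong, norm_gradient]
        exact mul_le_mul (h2.bound_fderiv _) (h1.bound_partialG _ _ hxR hgR) (norm_nonneg _) hg0)
    (gradient φ (xbar tf))
  exact ⟨lam, memW1Inf_of_lipschitzOnWith ht hK, hT, hode⟩

/-- The integrand of the derivative is measurable and bounded, linearly in the direction. -/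
theorem exists_sensitivityIntegrand_bound (ht : t0 ≤ tf) (hf : IsSmoothCaratheodory t0 tf f)
    (hl : IsSmoothCaratheodory t0 tf l) (hx : AbsolutelyContinuousOnInterval xbar t0 tf)
    {lam : ℝ → Vec nx} (hlam : AbsolutelyContinuousOnInterval lam t0 tf) :
    ∃ C, ∀ w : ComponentSpace t0 tf nx ng 2,
      AEStronglyMeasurable (sensitivityIntegrand f l gbar xbar lam w) (intervalMeasure t0 tf) ∧
      ∀ᵐ t ∂intervalMeasure t0 tf, ‖sensitivityIntegrand f l gbar xbar lam w t‖ ≤ C * ‖w‖ := by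
  obtain ⟨ρ, hρ0, hρ⟩ := exists_norm_le_of_absolutelyContinuous ht hx
  obtain ⟨Λ, hΛ0, hΛ⟩ := exists_norm_le_of_absolutelyContinuous ht hlam
  have hg0 := norm_nonneg gbar
  have hR0 : 0 < ρ + ‖gbar‖ + 1 := by positivity
  obtain ⟨C, hC, hb⟩ := hf.exists_hasLocalBounds hR0
  obtain ⟨C', hC', hb'⟩ := hl.exists_hasLocalBounds hR0
  refine ⟨Λ * C + C', fun w => ⟨?_, ?_⟩⟩
  · have hxm := aestronglyMeasurable_of_absolutelyContinuous ht hx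
    have hgm := gbar.aestronglyMeasurable_comp hxm
    have hwm := w.aestronglyMeasurable_comp hxm
    rw [funext (sensitivityIntegrand_eq (f := f) (l := l) (gbar : ℝ → Vec nx → Vec ng) xbar lam w)]
    exact ((aestronglyMeasurable_of_absolutelyContinuous ht hlam).inner
      (hf.aestronglyMeasurable_partialG hxm hgm hwm)).add
      (hl.aestronglyMeasurable_partialG hxm hgm hwm)
  · filter_upwards [hb, hb', gbar.ae_hasC2Bound, w.ae_hasC2Bound, ae_intervalMeasure_mem]
      with t h1 h2 h3 h4 h5
    have hxR : ‖xbar t‖ ≤ ρ + ‖gbar‖ + 1 := (hρ t (Ioo_subset_Icc_self h5)).trans (by linarith)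
    have hgR : ‖gbar t (xbar t)‖ ≤ ρ + ‖gbar‖ + 1 := (h3.bound _).trans (by linarith)
    have a1 : ‖partialG f t (xbar t) (gbar t (xbar t)) (w t (xbar t))‖ ≤ C * ‖w‖ :=
      (ContinuousLinearMap.le_opNorm _ _).trans
        (mul_le_mul (h1.bound_partialG _ _ hxR hgR) (h4.bound _) (norm_nonneg _) hC.le)
    have a2 : ‖partialG l t (xbar t) (gbar t (xbar t)) (w t (xbar t))‖ ≤ C' * ‖w‖ :=
      (ContinuousLinearMap.le_opNorm _ _).trans
        (mul_le_mul (h2.bound_partialG _ _ hxR hgR) (h4.bound _) (norm_nonneg _) hC'.le)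
    rw [sensitivityIntegrand_eq, add_mul, mul_assoc]
    exact (norm_add_le _ _).trans (add_le_add ((norm_inner_le_norm _ _).trans
      (mul_le_mul (hΛ t (Ioo_subset_Icc_self h5)) a1 (norm_nonneg _) hΛ0)) a2)

end Adjoint

/-! ### Differentiability of the reduced quantity of interest. -/

section Derivative

variable {t0 tf : ℝ} {nx ng : ℕ} {f : ℝ → Vec nx → Vec ng → Vec nx}
  {l : ℝ → Vec nx → Vec ng → ℝ} {φ : Vec nx → ℝ} {x0 : Vec nx}
  {gbar : ComponentSpace t0 tf nx ng 2} {xbar lam : ℝ → Vec nx}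

/-- Along a nearby state, the adjoint equation turns the first variation of the running cost into
the sensitivity integrand, up to a second-order remainder. -/
theorem exists_adjoint_remainder_bound (ht : t0 ≤ tf) (hf : IsSmoothCaratheodory t0 tf f)
    (hl : IsSmoothCaratheodory t0 tf l) (hx : AbsolutelyContinuousOnInterval xbar t0 tf)
    (hlam : AbsolutelyContinuousOnInterval lam t0 tf) :
    ∃ K, 0 ≤ K ∧ ∀ (g : ComponentSpace t0 tf nx ng 2) (x : ℝ → Vec nx), ‖g - gbar‖ ≤ 1 →
      (∀ t ∈ Icc t0 tf, ‖x t - xbar t‖ ≤ 1) → ∀ᵐ t ∂intervalMeasure t0 tf,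
        ‖inner ℝ (lam t) (f t (x t) (g t (x t)) - f t (xbar t) (gbar t (xbar t)))
          + inner ℝ (adjointField f l gbar xbar t (lam t)) (x t - xbar t)
          + (l t (x t) (g t (x t)) - l t (xbar t) (gbar t (xbar t)))
          - sensitivityIntegrand f l gbar xbar lam (g - gbar : ComponentSpace t0 tf nx ng 2) t‖
        ≤ K * (‖x t - xbar t‖ + ‖g - gbar‖) ^ 2 := by
  obtain ⟨ρ, hρ0, hρ⟩ := exists_norm_le_of_absolutelyContinuous ht hx
  obtain ⟨Λ, hΛ0, hΛ⟩ := exists_norm_le_of_absolutelyContinuous ht hlam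
  have hg0 := norm_nonneg gbar
  have hR0 : 0 < ρ + ‖gbar‖ + 1 := by positivity
  obtain ⟨C, hC, hb⟩ := hf.exists_hasLocalBounds hR0
  obtain ⟨C', hC', hb'⟩ := hl.exists_hasLocalBounds hR0
  refine ⟨Λ * (C * (‖gbar‖ + 2) ^ 2) + C' * (‖gbar‖ + 2) ^ 2, by positivity, fun g x hg hxx => ?_⟩
  filter_upwards [hb, hb', gbar.ae_hasC2Bound, g.ae_hasC2Bound, (g - gbar).ae_hasC2Bound,
    ae_intervalMeasure_mem] with t h1 h2 h3 h4 h5 h6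
  have h6' := Ioo_subset_Icc_self h6
  have hxR : ‖xbar t‖ ≤ ρ + ‖gbar‖ + 1 := (hρ t h6').trans (by linarith)
  have hyR : ‖x t‖ ≤ ρ + ‖gbar‖ + 1 := by
    have a1 : ‖x t‖ ≤ ‖xbar t‖ + ‖x t - xbar t‖ := norm_le_insert' _ _
    have a2 := hρ t h6'
    have a3 := hxx t h6'
    linarith
  have hvR : ∀ z, ‖gbar t z‖ ≤ ρ + ‖gbar‖ + 1 := fun z => (h3.bound z).trans (by linarith)
  have huR : ∀ z, ‖g t z‖ ≤ ρ + ‖gbar‖ + 1 :=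
    ComponentSpace.norm_apply_le_of_norm_sub_le_one hg (by linarith) h4
  have hd0 := norm_nonneg (g - gbar)
  have r1 := h1.norm_comp_taylor_le hC.le hg0 hd0 h3 h5 (fun z => rfl) huR hvR hxR hyR
  have r2 := h2.norm_comp_taylor_le hC'.le hg0 hd0 h3 h5 (fun z => rfl) huR hvR hxR hyR
  rw [inner_adjointField, sensitivityIntegrand_eq, matA_apply]
  -- The adjoint terms supply exactly the `x`-linear parts, and the sensitivity integrand the
  -- `g`-linear parts, so what remains is ⟨λ, Taylor remainder of f⟩ plus the Taylor remainder of l.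
  have e : ∀ (a b c : Vec nx) (p q r s : ℝ), inner ℝ (lam t) a
      + -(inner ℝ (lam t) b + p) + (q - r) - (inner ℝ (lam t) c + s)
      = inner ℝ (lam t) (a - b - c) + (q - r - p - s) := by
    intro a b c p q r s
    rw [inner_sub_right, inner_sub_right]
    ring
  rw [e, add_mul, mul_assoc]
  exact (norm_add_le _ _).trans (add_le_add ((norm_inner_le_norm _ _).trans
    (mul_le_mul (hΛ t h6') r1 (norm_nonneg _) hΛ0)) r2)

/-- The terminal term is rewritten as the integral of the derivative of ⟨λ, x − x̄⟩. All terms then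
stand under one integral, whose integrand is quadratically small by the pointwise estimate. The map
φ enters only through its derivative, so its own remainder is left for later. -/
theorem exists_reducedQoi_remainder_bound (ht : t0 ≤ tf) (hf : IsSmoothCaratheodory t0 tf f)
    (hl : IsSmoothCaratheodory t0 tf l) (hx : IsState t0 tf f x0 gbar xbar)
    (hlam : IsAdjointState t0 tf f φ l gbar xbar lam) :
    ∃ ε > 0, ∃ K, 0 ≤ K ∧ ∀ g : ComponentSpace t0 tf nx ng 2, ‖g - gbar‖ ≤ ε →
      ‖stateOf t0 tf f x0 g tf - xbar tf‖ ≤ K * ‖g - gbar‖ ∧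
      ‖fderiv ℝ φ (xbar tf) (stateOf t0 tf f x0 g tf - xbar tf)
        + ((∫ t in t0..tf, l t (stateOf t0 tf f x0 g t) (g t (stateOf t0 tf f x0 g t)))
          - ∫ t in t0..tf, l t (xbar t) (gbar t (xbar t)))
        - ∫ t in t0..tf, sensitivityIntegrand f l gbar xbar lam
            (g - gbar : ComponentSpace t0 tf nx ng 2) t‖ ≤ K * ‖g - gbar‖ ^ 2 := by
  obtain ⟨ε, hε, C, hC, hCε, hε1, hnear⟩ := hx.exists_nearby ht hf
  obtain ⟨K, hK, hrem⟩ := exists_adjoint_remainder_bound (gbar := gbar) ht hf hl hx.memW1Inf.1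
    hlam.memW1Inf.1
  obtain ⟨S, hS⟩ := exists_sensitivityIntegrand_bound (gbar := gbar) ht hf hl hx.memW1Inf.1
    hlam.memW1Inf.1
  have htt : 0 ≤ tf - t0 := sub_nonneg.2 ht
  refine ⟨ε, hε, C + K * (C + 1) ^ 2 * (tf - t0), by positivity, fun g hg => ?_⟩
  obtain ⟨y, hy, hyx⟩ := hnear g hg
  have hs : IsState t0 tf f x0 g (stateOf t0 tf f x0 g) := isState_stateOf ⟨y, hy⟩
  have hsx : ∀ t ∈ Icc t0 tf, ‖stateOf t0 tf f x0 g t - xbar t‖ ≤ C * ‖g - gbar‖ := by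
    intro t htm
    -- `stateOf` is an arbitrary choice among solutions; uniqueness transfers the estimate to it.
    rw [← hy.eqOn ht hf hs htm]
    exact hyx t htm
  generalize stateOf t0 tf f x0 (g : ℝ → Vec nx → Vec ng) = x at hs hsx ⊢
  have hd0 := norm_nonneg (g - gbar)
  have hD : 0 ≤ K * (C + 1) ^ 2 * (tf - t0) := by positivity
  refine ⟨(hsx tf (right_mem_Icc.2 ht)).trans
    (mul_le_mul_of_nonneg_right (le_add_of_nonneg_right hD) hd0), ?_⟩
  have hxx : ∀ t ∈ Icc t0 tf, ‖x t - xbar t‖ ≤ 1 := fun t htm =>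
    (hsx t htm).trans ((mul_le_mul_of_nonneg_left hg hC).trans hCε)
  obtain ⟨K₁, hL₁⟩ := hlam.memW1Inf.exists_lipschitzOnWith ht
    (hlam.ode.mono fun t h => h.differentiableAt)
  obtain ⟨K₂, hL₂⟩ := hs.memW1Inf.exists_lipschitzOnWith ht
    (hs.ode.mono fun t h => h.differentiableAt)
  obtain ⟨K₃, hL₃⟩ := hx.memW1Inf.exists_lipschitzOnWith ht
    (hx.ode.mono fun t h => h.differentiableAt)
  have hac := absolutelyContinuousOnInterval_inner ht hL₁ (hL₂.sub hL₃)
  have hψ := hac.integral_deriv_eq_sub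
  have hterm : fderiv ℝ φ (xbar tf) (x tf - xbar tf) =
      ∫ t in t0..tf, deriv (fun t => inner ℝ (lam t) (x t - xbar t)) t := by
    rw [hψ, hs.initial, hx.initial, sub_self, inner_zero_right, sub_zero, hlam.terminal,
      inner_gradient]
  have hi₁ := hac.intervalIntegrable_deriv
  have hi₂ := hs.intervalIntegrable ht hl
  have hi₃ := hx.intervalIntegrable ht hl
  have hi₄ := intervalIntegrable_of_ae_bounded ht (hS (g - gbar)).1 (hS (g - gbar)).2
  rw [hterm, ← intervalIntegral.integral_sub hi₂ hi₃, ← intervalIntegral.integral_add hi₁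
    (hi₂.sub hi₃), ← intervalIntegral.integral_sub (hi₁.add (hi₂.sub hi₃)) hi₄]
  have hfin := norm_integral_le_of_ae_bounded (C := K * ((C + 1) * ‖g - gbar‖) ^ 2) ht
    (h := fun t => deriv (fun t => inner ℝ (lam t) (x t - xbar t)) t
      + (l t (x t) (g t (x t)) - l t (xbar t) (gbar t (xbar t)))
      - sensitivityIntegrand f l gbar xbar lam (g - gbar : ComponentSpace t0 tf nx ng 2) t) (by
      filter_upwards [hrem g x (hg.trans hε1) hxx, hlam.ode, hs.ode, hx.ode,
        ae_intervalMeasure_mem] with t h1 h2 h3 h4 h5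
      have h6 : HasDerivAt (fun t => inner ℝ (lam t) (x t - xbar t)) _ t :=
        h2.inner ℝ (h3.sub h4)
      rw [h6.deriv]
      refine h1.trans (mul_le_mul_of_nonneg_left ?_ hK)
      have h7 := hsx t (Ioo_subset_Icc_self h5)
      exact pow_le_pow_left₀ (add_nonneg (norm_nonneg _) hd0) (by linarith) 2)
  refine hfin.trans ?_
  have : 0 ≤ C * ‖g - gbar‖ ^ 2 := mul_nonneg hC (sq_nonneg _)
  nlinarith

/-- The continuous linear functional `δg ↦ ∫ [Bᵀ λ + ∇_g l]ᵀ δg(t, x(t)) dt`. -/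
theorem exists_sensitivity_functional (ht : t0 ≤ tf) (hf : IsSmoothCaratheodory t0 tf f)
    (hl : IsSmoothCaratheodory t0 tf l) (hx : AbsolutelyContinuousOnInterval xbar t0 tf)
    (hlam : AbsolutelyContinuousOnInterval lam t0 tf) :
    ∃ D : ComponentSpace t0 tf nx ng 2 →L[ℝ] ℝ, ∀ w : ComponentSpace t0 tf nx ng 2,
      IntervalIntegrable (sensitivityIntegrand f l gbar xbar lam w) volume t0 tf ∧
      D w = ∫ t in t0..tf, sensitivityIntegrand f l gbar xbar lam w t := by
  obtain ⟨S, hS⟩ := exists_sensitivityIntegrand_bound (gbar := gbar) ht hf hl hx hlam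
  have hi : ∀ w : ComponentSpace t0 tf nx ng 2,
      IntervalIntegrable (sensitivityIntegrand f l gbar xbar lam w) volume t0 tf :=
    fun w => intervalIntegrable_of_ae_bounded ht (hS w).1 (hS w).2
  let D₀ : ComponentSpace t0 tf nx ng 2 →ₗ[ℝ] ℝ :=
    { toFun := fun w => ∫ t in t0..tf, sensitivityIntegrand f l gbar xbar lam w t
      map_add' := fun v w => by
        rw [← intervalIntegral.integral_add (hi v) (hi w)]
        exact intervalIntegral.integral_congr fun t _ => inner_add_right _ _ _
      map_smul' := fun c w => by
        rw [RingHom.id_apply, ← intervalIntegral.integral_smul]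
        exact intervalIntegral.integral_congr fun t _ => real_inner_smul_right _ _ _ }
  refine ⟨D₀.mkContinuous (S * (tf - t0)) fun w => ?_, fun w => ⟨hi w, rfl⟩⟩
  refine (norm_integral_le_of_ae_bounded ht (hS w).2).trans (le_of_eq ?_)
  ring

/-- The increment minus D(g − ḡ) splits into the remainder of φ at x̄(tf), which is o(‖x(tf) −
x̄(tf)‖) and hence o(‖g − ḡ‖), and the quadratic remainder of the adjoint identity. -/
theorem hasFDerivAt_reducedQoi (ht : t0 ≤ tf) (hf : IsSmoothCaratheodory t0 tf f)
    (hl : IsSmoothCaratheodory t0 tf l) (hφ : DifferentiableAt ℝ φ (xbar tf))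
    (hx : IsState t0 tf f x0 gbar xbar) (hlam : IsAdjointState t0 tf f φ l gbar xbar lam)
    {D : ComponentSpace t0 tf nx ng 2 →L[ℝ] ℝ}
    (hD : ∀ w : ComponentSpace t0 tf nx ng 2,
      D w = ∫ t in t0..tf, sensitivityIntegrand f l gbar xbar lam w t) :
    HasFDerivAt (reducedQoi t0 tf f x0 φ l) D gbar := by
  obtain ⟨ε, hε, K, hK, hrem⟩ := exists_reducedQoi_remainder_bound ht hf hl hx hlam
  have hev : ∀ᶠ g : ComponentSpace t0 tf nx ng 2 in 𝓝 gbar, ‖g - gbar‖ ≤ ε := by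
    filter_upwards [Metric.closedBall_mem_nhds gbar hε] with g hg
    rwa [mem_closedBall_iff_norm] at hg
  have hO : (fun g : ComponentSpace t0 tf nx ng 2 => stateOf t0 tf f x0 g tf - xbar tf)
      =O[𝓝 gbar] fun g => g - gbar :=
    Asymptotics.IsBigO.of_bound K (hev.mono fun g hg => (hrem g hg).1)
  have ht0 : Tendsto (fun g : ComponentSpace t0 tf nx ng 2 => g - gbar) (𝓝 gbar) (𝓝 0) := by
    have : Continuous fun g : ComponentSpace t0 tf nx ng 2 => g - gbar := by fun_prop
    simpa using this.tendsto gbar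
  have hX : Tendsto (fun g : ComponentSpace t0 tf nx ng 2 => stateOf t0 tf f x0 g tf) (𝓝 gbar)
      (𝓝 (xbar tf)) :=
    tendsto_sub_nhds_zero_iff.1 (hO.norm_right.trans_tendsto (by simpa using ht0.norm))
  have h1 := (hφ.hasFDerivAt.isLittleO.comp_tendsto hX).trans_isBigO hO
  have hsq : (fun g : ComponentSpace t0 tf nx ng 2 => ‖g - gbar‖ ^ 2) =o[𝓝 gbar]
      fun g => g - gbar :=
    ((Asymptotics.isLittleO_norm_pow_id (E' := ComponentSpace t0 tf nx ng 2)
      one_lt_two).comp_tendsto ht0)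
  have h2 : (fun g : ComponentSpace t0 tf nx ng 2 =>
      fderiv ℝ φ (xbar tf) (stateOf t0 tf f x0 g tf - xbar tf)
        + ((∫ t in t0..tf, l t (stateOf t0 tf f x0 g t) (g t (stateOf t0 tf f x0 g t)))
          - ∫ t in t0..tf, l t (xbar t) (gbar t (xbar t)))
        - D (g - gbar)) =o[𝓝 gbar] fun g => g - gbar := by
    refine (Asymptotics.IsBigO.of_bound K (hev.mono fun g hg => ?_)).trans_isLittleO hsq
    rw [hD, norm_pow, norm_norm]
    exact (hrem g hg).2
  -- The chosen state for `gbar` need agree with `xbar` only on `Icc t0 tf`, which is all that `qoi`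
  -- sees.
  have hbar : reducedQoi t0 tf f x0 φ l gbar = qoi t0 tf φ l xbar gbar := by
    have heq := (isState_stateOf ⟨xbar, hx⟩).eqOn ht hf hx
    rw [reducedQoi, qoi, qoi, heq (right_mem_Icc.2 ht)]
    congr 1
    refine intervalIntegral.integral_congr fun t htm => ?_
    rw [uIcc_of_le ht] at htm
    simp only [heq htm]
  rw [hasFDerivAt_iff_isLittleO]
  refine (h1.add h2).congr_left fun g => ?_
  rw [hbar]
  simp only [reducedQoi, qoi, Function.comp_apply]
  ring

end Derivative

end ODESensitivity

/-! ### The main theorem. -/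

theorem theorem2p10 (nx ng : ℕ) (t0 tf : ℝ) (ht : t0 < tf)
    (f : ℝ → ODESensitivity.Vec nx → ODESensitivity.Vec ng → ODESensitivity.Vec nx)
    (l : ℝ → ODESensitivity.Vec nx → ODESensitivity.Vec ng → ℝ)
    (φ : ODESensitivity.Vec nx → ℝ) (x0 : ODESensitivity.Vec nx)
    (hf : ODESensitivity.IsSmoothCaratheodory t0 tf f)
    (hl : ODESensitivity.IsSmoothCaratheodory t0 tf l)
    (hφ : ContDiff ℝ 1 φ)
    (gbar : ODESensitivity.ComponentSpace t0 tf nx ng 2)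
    (xbar : ℝ → ODESensitivity.Vec nx)
    (hx : ODESensitivity.IsState t0 tf f x0 gbar xbar) :
    -- near `gbar` the state exists and is unique, and the integral in `q` converges
    (∀ᶠ g : ODESensitivity.ComponentSpace t0 tf nx ng 2 in 𝓝 gbar,
      (∃ x, ODESensitivity.IsState t0 tf f x0 g x) ∧
      ∀ x, ODESensitivity.IsState t0 tf f x0 g x →
        EqOn x (ODESensitivity.stateOf t0 tf f x0 g) (Icc t0 tf) ∧
        IntervalIntegrable (fun t => l t (x t) (g t (x t))) volume t0 tf) ∧
    (∃ lam, ODESensitivity.IsAdjointState t0 tf f φ l gbar xbar lam) ∧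
    ∃ D : ODESensitivity.ComponentSpace t0 tf nx ng 2 →L[ℝ] ℝ,
      HasFDerivAt (ODESensitivity.reducedQoi t0 tf f x0 φ l) D gbar ∧
      ∀ lam, ODESensitivity.IsAdjointState t0 tf f φ l gbar xbar lam →
        ∀ δg : ODESensitivity.ComponentSpace t0 tf nx ng 2,
          IntervalIntegrable (fun t =>
            inner ℝ (ContinuousLinearMap.adjoint (ODESensitivity.matB f gbar xbar t) (lam t)
              + ODESensitivity.gradGAlong l gbar xbar t) (δg t (xbar t))) volume t0 tf ∧
          D δg = ∫ t in t0..tf,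
            inner ℝ (ContinuousLinearMap.adjoint (ODESensitivity.matB f gbar xbar t) (lam t)
              + ODESensitivity.gradGAlong l gbar xbar t) (δg t (xbar t)) := by
  obtain ⟨ε, hε, _, -, -, -, hnear⟩ := hx.exists_nearby ht.le hf
  obtain ⟨lam₀, hlam₀⟩ :=
    ODESensitivity.exists_isAdjointState (φ := φ) (gbar := gbar) ht.le hf hl hx.memW1Inf.1
  obtain ⟨D, hD⟩ := ODESensitivity.exists_sensitivity_functional (gbar := gbar) ht.le hf hl
    hx.memW1Inf.1 hlam₀.memW1Inf.1
  have hφd : DifferentiableAt ℝ φ (xbar tf) := hφ.differentiable (by norm_num) _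
  have hDd := ODESensitivity.hasFDerivAt_reducedQoi ht.le hf hl hφd hx hlam₀ fun w => (hD w).2
  refine ⟨?_, ⟨lam₀, hlam₀⟩, D, hDd, fun lam hlam w => ?_⟩
  · filter_upwards [Metric.closedBall_mem_nhds gbar hε] with g hg
    rw [mem_closedBall_iff_norm] at hg
    obtain ⟨y, hy, -⟩ := hnear g hg
    exact ⟨⟨y, hy⟩, fun x hxg =>
      ⟨hxg.eqOn ht.le hf (ODESensitivity.isState_stateOf ⟨y, hy⟩), hxg.intervalIntegrable ht.le hl⟩⟩
  · obtain ⟨D', hD'⟩ := ODESensitivity.exists_sensitivity_functional (gbar := gbar) ht.le hf hl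
      hx.memW1Inf.1 hlam.memW1Inf.1
    have hDd' := ODESensitivity.hasFDerivAt_reducedQoi ht.le hf hl hφd hx hlam fun w => (hD' w).2
    -- `D` was built from the single adjoint state `lam₀`. Any other adjoint state also represents
    -- the derivative, so uniqueness of the Fréchet derivative gives the formula without uniqueness
    -- for the adjoint equation.
    rw [hDd.unique hDd']
    exact hD' w
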